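/- Let $(I,\preceq)$ be a finite partially ordered set. For $i,j\in I$ let $\mathcal A_{ij}$ be finite-dimensional real vector spaces with $\mathcal A_{ii}=\mathbb R$, $\mathcal A_{ij}=\{0\}$ if $i,j$ are incomparable, and $n_{ij}=\dim\mathcal A_{ij}>0$ if $j\prec i$. Let $\mathcal A=\prod_{i,j}\mathcal A_{ij}$ be a Vinberg algebra: it carries a matrix multiplication $(AB)_{ik}=\sum_j a_{ij}b_{jk}$ given by bilinear maps $\mathcal A_{ij}\times\mathcal A_{jk}\to\mathcal A_{ik}$, with unit $e=\mathrm{diag}(1,\dots,1)$, and a linear involution $A\mapsto A^*$ mapping the $(i,j)$ entry linearly into the $(j,i)$ entry and fixing diagonal entries, such that, with $\operatorname{tr}A=\sum_i a_{ii}$ and $\mathcal T_l=\{A: a_{ij}=0\text{ unless }j\preceq i\}$: (i) $\operatorname{tr}(AA^*)>0$ for $A\ne0$; (ii) $(AB)^*=B^*A^*$; (iii) $\operatorname{tr}(AB)=\operatorname{tr}(BA)$; (iv) $\operatorname{tr}(A(BC))=\operatorname{tr}((AB)C)$; (v) $(ST)U=S(TU)$ and (vi) $T(UU^*)=(TU)U^*$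 for $S,T,U\in\mathcal T_l$. Let $\mathcal H=\{A: A^*=A\}$, let $\mathcal T_l^+$ be the group of all $T\in\mathcal T_l$ with positive diagonal entries, let $\mathcal P=\{TT^*: T\in\mathcal T_l^+\}\subset\mathcal H$ be the associated homogeneous cone, and let $\mathcal P^*=\{\theta\in\mathcal H:\operatorname{tr}(\theta Z)>0\text{ for all }Z\in\overline{\mathcal P}\setminus\{0\}\}$ be its open dual cone; every $\theta\in\mathcal P^*$ is $T^*T$ for a unique $T\in\mathcal T_l^+$, and $\theta^{-1}:=T^{-1}(T^{-1})^*\in\mathcal P$. Let $dZ=\prod_i dz_{ii}\prod_{j\prec i}dz_{ij}$ be Lebesgue measure on $\mathcal H$, where $dz_{ij}$ is the Lebesgue measure of the Euclidean space $\mathcal A_{ij}$ with $\|a\|^2=aa^*$. Put $$n_{i\cdot}=\sum_{\mu\prec i}n_{i\mu},\quad n_{\cdot i}=\sum_{i\prec\mu}n_{\mu i},\quad n_i=1+\tfrac12(n_{i\cdot}+n_{\cdot i}),\quad n_\cdot=\sum_{i\in I}n_i .$$ For $\chi=(\lambda_i)_{i\in I}\in\mathbb R^I$ and $X=TT^*\in\mathcal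 P$ with $T=(t_{ij})\in\mathcal T_l^+$ let $$\Delta_\chi(X)=\prod_{k\in I}\left(\frac{\prod_{j\preceq k}t_{jj}^2}{\prod_{j\prec k}t_{jj}^2}\right)^{\lambda_k}.$$ A Riesz measure $R_\chi$ is a positive Borel measure on $\mathcal H$, concentrated on $\overline{\mathcal P}$, with $$\int e^{-\operatorname{tr}(\theta Z)}\,R_\chi(dZ)=\Delta_\chi(\theta^{-1})\qquad\text{for all }\theta\in\mathcal P^* .$$ **Proposition 3.5.** Let $\chi=(\lambda_i)_{i\in I}\in\mathbb R^I$. A Riesz measure $R_\chi$ is absolutely continuous with respect to $dZ$ if and only if $\lambda_i>n_{i\cdot}/2$ for all $i\in I$. If $\lambda_i>n_{i\cdot}/2$ for all $i\in I$, then $R_\chi$ exists, is unique, and $$R_\chi(dZ)=\frac1{\Gamma_{\mathcal P}(\chi)}\,\Delta_{\chi+\ddot\chi}(Z)\,1_{\mathcal P}(Z)\,dZ,\qquad \ddot\chi=(-n_i)_{i\in I},\qquad \Gamma_{\mathcal P}(\chi)=\pi^{\frac{n_\cdot-|I|}2}\prod_{i\in I}\Gamma\!\left(\lambda_i-\tfrac{n_{i\cdot}}2\right).$$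 -/

import Mathlib

open MeasureTheory

/-- The "matrices" `(a i j)` with entries `a i j` in the spaces `A i j`. -/
abbrev VinMat {I : Type*} (A : I → I → Type*) : Type _ := ∀ i j, A i j

/-- The operations of a Vinberg algebra on entries: an identification of every diagonal space with
`ℝ`, bilinear products `A i j × A j k → A i k`, and linear maps `a ↦ a^*` from `A i j` to `A j i`. -/
structure VinbergData {I : Type*} (A : I → I → Type*)
    [∀ i j, NormedAddCommGroup (A i j)] [∀ i j, InnerProductSpace ℝ (A i j)] where
  scal : ∀ i, A i i ≃ₗ[ℝ] ℝ
  emul : ∀ i j k, A i j →ₗ[ℝ] A j k →ₗ[ℝ] A i k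
  eadj : ∀ i j, A i j →ₗ[ℝ] A j i

namespace VinbergData

variable {I : Type*} [Fintype I] [PartialOrder I] {A : I → I → Type*}
  [∀ i j, NormedAddCommGroup (A i j)] [∀ i j, InnerProductSpace ℝ (A i j)]

/-- Matrix product. -/
noncomputable def mul (V : VinbergData A) (X Y : VinMat A) : VinMat A :=
  fun i k => ∑ j, V.emul i j k (X i j) (Y j k)

/-- The involution `X ↦ X^*`. -/
def adj (V : VinbergData A) (X : VinMat A) : VinMat A := fun i j => V.eadj j i (X j i)

/-- The trace. -/
noncomputable def tr (V : VinbergData A) (X : VinMat A) : ℝ := ∑ i, V.scal i (X i i)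

open Classical in
/-- The unit matrix `e`. -/
noncomputable def one (V : VinbergData A) : VinMat A :=
  fun i j => if h : i = j then h ▸ (V.scal i).symm 1 else 0

/-- Lower triangular matrices `𝒯_l`: the entry `(i, j)` vanishes unless `j ≼ i`. -/
def lower (_V : VinbergData A) : Set (VinMat A) := {T | ∀ i j, ¬ j ≤ i → T i j = 0}

/-- Lower triangular matrices with positive diagonal, `𝒯_l^+`. -/
def lowerPos (V : VinbergData A) : Set (VinMat A) := {T | T ∈ V.lower ∧ ∀ i, 0 < V.scal i (T i i)}

/-- The space `ℋ` of Hermitian matrices. -/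
def herm (V : VinbergData A) : Submodule ℝ (VinMat A) where
  carrier := {X | V.adj X = X}
  add_mem' := by
    intro X Y hX hY
    funext i j
    have h1 := congrFun (congrFun hX i) j
    have h2 := congrFun (congrFun hY i) j
    simp only [adj] at h1 h2
    simp [adj, h1, h2]
  zero_mem' := by
    funext i j
    simp [adj]
  smul_mem' := by
    intro c X hX
    funext i j
    have h1 := congrFun (congrFun hX i) j
    simp only [adj] at h1
    simp [adj, h1]

end VinbergData

/-- A Vinberg algebra over the finite poset `I`. The Euclidean structure of each `A i j` is the one
of the algebra itself: `‖a‖ ^ 2 = a a^*`. -/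
structure VinbergAlgebra {I : Type*} [Fintype I] [PartialOrder I] (A : I → I → Type*)
    [∀ i j, NormedAddCommGroup (A i j)] [∀ i j, InnerProductSpace ℝ (A i j)]
    extends VinbergData A where
  nontrivial_of_lt : ∀ i j, j < i → Nontrivial (A i j)
  subsingleton_of_incomp : ∀ i j, ¬ i ≤ j → ¬ j ≤ i → Subsingleton (A i j)
  scal_eadj : ∀ i a, scal i (eadj i i a) = scal i a
  eadj_eadj : ∀ i j a, eadj j i (eadj i j a) = a
  norm_sq_eq : ∀ i j (a : A i j), ‖a‖ ^ 2 = scal i (emul i j i a (eadj i j a))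
  one_mul : ∀ X, toVinbergData.mul toVinbergData.one X = X
  mul_one : ∀ X, toVinbergData.mul X toVinbergData.one = X
  tr_pos : ∀ X, X ≠ 0 → 0 < toVinbergData.tr (toVinbergData.mul X (toVinbergData.adj X))
  adj_mul : ∀ X Y, toVinbergData.adj (toVinbergData.mul X Y) =
    toVinbergData.mul (toVinbergData.adj Y) (toVinbergData.adj X)
  tr_comm : ∀ X Y, toVinbergData.tr (toVinbergData.mul X Y) =
    toVinbergData.tr (toVinbergData.mul Y X)
  tr_assoc : ∀ X Y Z, toVinbergData.tr (toVinbergData.mul X (toVinbergData.mul Y Z)) =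
    toVinbergData.tr (toVinbergData.mul (toVinbergData.mul X Y) Z)
  lower_assoc : ∀ S ∈ toVinbergData.lower, ∀ T ∈ toVinbergData.lower, ∀ U ∈ toVinbergData.lower,
    toVinbergData.mul (toVinbergData.mul S T) U = toVinbergData.mul S (toVinbergData.mul T U)
  lower_adj_assoc : ∀ T ∈ toVinbergData.lower, ∀ U ∈ toVinbergData.lower,
    toVinbergData.mul T (toVinbergData.mul U (toVinbergData.adj U)) =
      toVinbergData.mul (toVinbergData.mul T U) (toVinbergData.adj U)

namespace VinbergAlgebra

variable {I : Type*} [Fintype I] [PartialOrder I] {A : I → I → Type*}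
  [∀ i j, NormedAddCommGroup (A i j)] [∀ i j, InnerProductSpace ℝ (A i j)]

/-- The homogeneous cone `𝒫 = {T T^* : T ∈ 𝒯_l^+}`, as a subset of `ℋ`. -/
def cone (V : VinbergAlgebra A) : Set V.herm :=
  {Z | ∃ T ∈ V.lowerPos, V.mul T (V.adj T) = Z}

/-- The (open) dual cone `𝒫^*`, with `ℋ` identified with its dual through `(X, Y) ↦ tr (X Y)`. -/
def dualCone (V : VinbergAlgebra A) : Set V.herm :=
  {θ | ∀ Z ∈ closure V.cone, Z ≠ 0 → 0 < V.tr (V.mul θ Z)}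

/-- The factor `T ∈ 𝒯_l^+` of `Z = T T^* ∈ 𝒫`. -/
noncomputable def factor (V : VinbergAlgebra A) (Z : VinMat A) : VinMat A :=
  Classical.epsilon fun T => T ∈ V.lowerPos ∧ V.mul T (V.adj T) = Z

/-- The factor `T ∈ 𝒯_l^+` of `θ = T^* T ∈ 𝒫^*`. -/
noncomputable def dualFactor (V : VinbergAlgebra A) (θ : VinMat A) : VinMat A :=
  Classical.epsilon fun T => T ∈ V.lowerPos ∧ V.mul (V.adj T) T = θ

/-- The inverse of `T` in the group `𝒯_l^+`. -/
noncomputable def lowerInv (V : VinbergAlgebra A) (T : VinMat A) : VinMat A :=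
  Classical.epsilon fun S => S ∈ V.lowerPos ∧ V.mul T S = V.one ∧ V.mul S T = V.one

/-- The inverse `θ⁻¹ = T⁻¹ (T⁻¹)^* ∈ 𝒫` of `θ = T^* T ∈ 𝒫^*`. -/
noncomputable def dualInv (V : VinbergAlgebra A) (θ : VinMat A) : VinMat A :=
  V.mul (V.lowerInv (V.dualFactor θ)) (V.adj (V.lowerInv (V.dualFactor θ)))

open Classical in
/-- Large principal minor `∏_{j ≼ k} t_{jj}^2` of `X = T T^*`. -/
noncomputable def largeMinor (V : VinbergAlgebra A) (k : I) (X : VinMat A) : ℝ :=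
  ∏ j with j ≤ k, V.scal j (V.factor X j j) ^ 2

open Classical in
/-- Strict principal minor `∏_{j ≺ k} t_{jj}^2` of `X = T T^*`. -/
noncomputable def strictMinor (V : VinbergAlgebra A) (k : I) (X : VinMat A) : ℝ :=
  ∏ j with j < k, V.scal j (V.factor X j j) ^ 2

/-- The generalized power `Δ_χ(X)`, `X ∈ 𝒫`, of the multiplier `χ = (λ_i)`. -/
noncomputable def genPower (V : VinbergAlgebra A) (χ : I → ℝ) (X : VinMat A) : ℝ :=
  ∏ k, (V.largeMinor k X / V.strictMinor k X) ^ χ k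

open Classical in
/-- `n_{i·} = ∑_{μ ≺ i} dim A_{iμ}`. -/
noncomputable def nRow (_V : VinbergAlgebra A) (i : I) : ℕ :=
  ∑ m with m < i, Module.finrank ℝ (A i m)

open Classical in
/-- `n_{·i} = ∑_{i ≺ μ} dim A_{μi}`. -/
noncomputable def nCol (_V : VinbergAlgebra A) (i : I) : ℕ :=
  ∑ m with i < m, Module.finrank ℝ (A m i)

/-- `n_i = 1 + (n_{i·} + n_{·i}) / 2`. -/
noncomputable def nVal (V : VinbergAlgebra A) (i : I) : ℝ :=
  1 + ((V.nRow i : ℝ) + (V.nCol i : ℝ)) / 2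

/-- `n_· = ∑ n_i`. -/
noncomputable def nTot (V : VinbergAlgebra A) : ℝ := ∑ i, V.nVal i

/-- `Γ_𝒫(χ) = π^((n_· - |I|)/2) ∏ Γ(λ_i - n_{i·}/2)`. -/
noncomputable def gammaCone (V : VinbergAlgebra A) (χ : I → ℝ) : ℝ :=
  Real.pi ^ ((V.nTot - (Fintype.card I : ℝ)) / 2) *
    ∏ i, Real.Gamma (χ i - (V.nRow i : ℝ) / 2)

/-- The coordinates `(z_{ij})_{j ≼ i}`, which determine a Hermitian matrix. -/
def lowerCoords (V : VinbergAlgebra A) (Z : V.herm) :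
    ∀ p : {p : I × I // p.2 ≤ p.1}, A p.1.1 p.1.2 :=
  fun p => (Z : VinMat A) p.1.1 p.1.2

variable [∀ i j, FiniteDimensional ℝ (A i j)] [∀ i j, MeasurableSpace (A i j)]
  [∀ i j, BorelSpace (A i j)]

open Classical in
/-- Lebesgue measure `dZ = ∏_i dz_{ii} ∏_{j ≺ i} dz_{ij}` on `ℋ`, where `dz_{ij}` is the Lebesgue
measure of the Euclidean space `A i j`. -/
noncomputable def lebesgue (V : VinbergAlgebra A) : Measure V.herm :=
  Measure.comap V.lowerCoords volume

/-- `ρ` is a Riesz measure `R_χ`: a positive measure on the closed cone `closure 𝒫` whose Laplace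
transform is `θ ↦ Δ_χ(θ⁻¹)` on `𝒫^*`. -/
def IsRiesz (V : VinbergAlgebra A) (χ : I → ℝ) (ρ : Measure V.herm) : Prop :=
  ρ (closure V.cone)ᶜ = 0 ∧
    ∀ θ ∈ V.dualCone, ∫⁻ Z, ENNReal.ofReal (Real.exp (-V.tr (V.mul θ Z))) ∂ρ =
      ENNReal.ofReal (V.genPower χ (V.dualInv θ))

end VinbergAlgebra

/-!
The group `𝒯_l^+` of lower triangular matrices with positive diagonal acts simply transitively on
the cone `𝒫` through `g ↦ g g^*` and on the dual cone through `g ↦ g^* g`, and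
`tr (g^* g · h h^*) = tr (gh (gh)^*)`. Hence, in the coordinate `h`, the Laplace transform at
`g^* g` of a measure carried by `𝒫` is the integral of `exp (-‖gh‖²)`, and since Laplace transforms
determine measures, `R` is a Riesz measure for `χ` exactly when it is relatively left invariant on
the group with multiplier `χ` and gives `exp (-‖h‖²)` the integral `1`. Such a measure is the
Haar measure times a character, up to a scalar. An absolutely continuous Riesz measure is carried by
`𝒫`, because the boundary of `𝒫` is a null set; the normalizing integral is a product of Gaussian
integrals over the entries below the diagonal and of Gamma integrals over the diagonal entries, and
these are finite exactly when `λ_i > n_{i·} / 2` for all `i`.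
-/

/-! ### Integrals, determinants and Laplace transforms -/

section Integrals

open scoped ENNReal

theorem lintegral_pi_prod_eq_prod {ι : Type*} [Fintype ι] {E : ι → Type*}
    [∀ i, MeasurableSpace (E i)] (μ : ∀ i, Measure (E i)) [∀ i, SigmaFinite (μ i)]
    {f : ∀ i, E i → ℝ≥0∞} (hf : ∀ i, Measurable (f i)) :
    ∫⁻ x, ∏ i, f i (x i) ∂Measure.pi μ = ∏ i, ∫⁻ x, f i x ∂μ i := by
  classical
  have hmeas : ∀ s : Finset ι, Measurable fun x : ∀ i, E i => ∏ i ∈ s, f i (x i) := fun s =>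
    Finset.measurable_prod _ fun i _ => (hf i).comp (measurable_pi_apply i)
  have marginal : ∀ s : Finset ι, (∫⋯∫⁻_s, (fun x => ∏ i ∈ s, f i (x i)) ∂μ) =
      fun _ => ∏ i ∈ s, ∫⁻ x, f i x ∂μ i := by
    intro s
    induction s using Finset.induction_on with
    | empty => simp
    | insert j s hj ih =>
      have hint : ∀ x : ∀ i, E i, ∫⁻ y, ∏ i ∈ insert j s, f i (Function.update x j y i) ∂μ j =
          (∫⁻ y, f j y ∂μ j) * ∏ i ∈ s, f i (x i) := fun x => by
        rw [← lintegral_mul_const _ (hf j)]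
        refine lintegral_congr fun y => ?_
        rw [Finset.prod_insert hj, Function.update_self]
        refine congrArg _ (Finset.prod_congr rfl fun i hi => ?_)
        rw [Function.update_of_ne (ne_of_mem_of_not_mem hi hj)]
      rw [lmarginal_insert' _ (hmeas _) hj]
      simp only [hint]
      funext x
      rw [Finset.prod_insert hj, ← congrFun ih x]
      exact lintegral_const_mul _ ((hmeas s).comp measurable_updateFinset)
  rcases isEmpty_or_nonempty (∀ i, E i) with h | ⟨⟨x⟩⟩
  · obtain ⟨i, hi⟩ := isEmpty_pi.1 h
    rw [Finset.prod_eq_zero (Finset.mem_univ i) (by simp [Measure.eq_zero_of_isEmpty])]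
    simp [Measure.eq_zero_of_isEmpty]
  · rw [lintegral_eq_lmarginal_univ x, marginal]

theorem neg_one_lt_of_lintegral_rpow_mul_exp_ne_top {a : ℝ}
    (h : ∫⁻ t in Set.Ioi (0 : ℝ), ENNReal.ofReal (t ^ a * Real.exp (-t ^ 2)) ≠ ⊤) : -1 < a := by
  rw [← intervalIntegral.integrableOn_Ioo_rpow_iff zero_lt_one]
  have hint : IntegrableOn (fun t : ℝ => t ^ a * Real.exp (-t ^ 2)) (Set.Ioi 0) := by
    refine (lintegral_ofReal_ne_top_iff_integrable (by fun_prop) ?_).1 h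
    filter_upwards [ae_restrict_mem measurableSet_Ioi] with t ht
    exact mul_nonneg (Real.rpow_nonneg (le_of_lt ht) _) (Real.exp_pos _).le
  refine ((hint.mono_set Set.Ioo_subset_Ioi_self).const_mul (Real.exp 1)).mono' (by fun_prop) ?_
  filter_upwards [ae_restrict_mem measurableSet_Ioo] with t ht
  have hexp : 1 ≤ Real.exp 1 * Real.exp (-t ^ 2) := by
    rw [← Real.exp_add]
    exact Real.one_le_exp (by nlinarith [ht.1, ht.2])
  rw [Real.norm_of_nonneg (Real.rpow_nonneg ht.1.le _)]
  nlinarith [Real.rpow_nonneg ht.1.le a]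

theorem lintegral_rpow_mul_exp_neg_sq_ne_zero (a : ℝ) :
    ∫⁻ t in Set.Ioi (0 : ℝ), ENNReal.ofReal (t ^ a * Real.exp (-t ^ 2)) ≠ 0 := by
  have hsub : Set.Ioi (0 : ℝ) ⊆
      Function.support fun t => ENNReal.ofReal (t ^ a * Real.exp (-t ^ 2)) := fun t ht =>
    (ENNReal.ofReal_pos.2 (mul_pos (Real.rpow_pos_of_pos ht a) (Real.exp_pos _))).ne'
  rw [← pos_iff_ne_zero, setLIntegral_pos_iff (by fun_prop), Set.inter_eq_right.2 hsub]
  simp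

theorem lintegral_rpow_mul_exp_neg_sq {a : ℝ} (ha : -1 < a) :
    ∫⁻ t in Set.Ioi (0 : ℝ), ENNReal.ofReal (t ^ a * Real.exp (-t ^ 2)) =
      ENNReal.ofReal (1 / 2 * Real.Gamma ((a + 1) / 2)) := by
  have hval := integral_rpow_mul_exp_neg_rpow (p := 2) (q := a) two_pos ha
  have hint := integrableOn_rpow_mul_exp_neg_rpow (p := 2) ha two_pos
  simp only [Real.rpow_two] at hval hint
  rw [← hval, ofReal_integral_eq_lintegral_ofReal hint]
  filter_upwards [ae_restrict_mem measurableSet_Ioi] with t ht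
  exact mul_nonneg (Real.rpow_nonneg (le_of_lt ht) _) (Real.exp_pos _).le

theorem lintegral_exp_neg_norm_sq (W : Type*) [NormedAddCommGroup W] [InnerProductSpace ℝ W]
    [FiniteDimensional ℝ W] [MeasurableSpace W] [BorelSpace W] :
    ∫⁻ v : W, ENNReal.ofReal (Real.exp (-‖v‖ ^ 2)) =
      ENNReal.ofReal (Real.pi ^ ((Module.finrank ℝ W : ℝ) / 2)) := by
  have hval := GaussianFourier.integral_rexp_neg_mul_sq_norm (V := W) (b := 1) one_pos
  simp only [neg_mul, one_mul, div_one] at hval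
  have hint : Integrable fun v : W => Real.exp (-‖v‖ ^ 2) := by
    by_contra hc
    exact (Real.rpow_pos_of_pos Real.pi_pos _).ne (integral_undef hc ▸ hval)
  rw [← hval, ofReal_integral_eq_lintegral_ofReal hint
    (Filter.Eventually.of_forall fun _ => (Real.exp_pos _).le)]

theorem sigmaFinite_of_lintegral_ne_top {α : Type*} [MeasurableSpace α] {μ : Measure α}
    {f : α → ℝ≥0∞} (hf : Measurable f) (hpos : ∀ x, f x ≠ 0) (htop : ∫⁻ x, f x ∂μ ≠ ⊤) :
    SigmaFinite μ := by
  have : IsFiniteMeasure (μ.withDensity f) := isFiniteMeasure_withDensity htop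
  rw [← withDensity_inv_same hf (.of_forall hpos) (ae_lt_top hf htop |>.mono fun _ h => h.ne)]
  exact .withDensity_of_ne_top (.of_forall fun x => ENNReal.inv_ne_top.2 (hpos x))

theorem withDensity_map {α β : Type*} [MeasurableSpace α] [MeasurableSpace β]
    {e : α → β} (he : MeasurableEmbedding e) (μ : Measure α) (f : β → ENNReal) :
    (μ.map e).withDensity f = (μ.withDensity (f ∘ e)).map e := by
  ext s hs
  rw [withDensity_apply _ hs, he.map_apply, withDensity_apply _ (he.measurable hs),
    he.restrict_map, he.lintegral_map]
  rfl

end Integrals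

section Determinants

theorem det_eq_prod_diag_of_blockTriangular {R m α : Type*} [CommRing R] [Fintype m]
    [DecidableEq m] [LinearOrder α] {M : Matrix m m R} {b : m → α} (hM : M.BlockTriangular b)
    (hdiag : ∀ s t, b s = b t → s ≠ t → M s t = 0) : M.det = ∏ s, M s s := by
  have hblock : ∀ a, (M.toSquareBlock b a).det = ∏ s with b s = a, M s s := by
    intro a
    have : M.toSquareBlock b a = Matrix.diagonal fun s => M s.1 s.1 := by
      ext s t
      by_cases hst : s = t
      · rw [hst, Matrix.toSquareBlock_def, Matrix.of_apply, Matrix.diagonal_apply_eq]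
      · rw [Matrix.diagonal_apply_ne _ hst]
        exact hdiag s t (s.2.trans t.2.symm) (Subtype.coe_injective.ne hst)
    rw [this, Matrix.det_diagonal]
    exact (Finset.prod_subtype (Finset.univ.filter fun s => b s = a) (by simp) fun s => M s s).symm
  rw [hM.det, Finset.prod_congr rfl fun a _ => hblock a, Finset.prod_fiberwise_of_maps_to
    fun s _ => Finset.mem_image_of_mem _ (Finset.mem_univ s)]

theorem det_pi_of_triangular {K ι α : Type*} [Field K] [Fintype ι] [LinearOrder α] {E : ι → Type*}
    [∀ p, AddCommGroup (E p)] [∀ p, Module K (E p)] [∀ p, FiniteDimensional K (E p)]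
    (L : (∀ p, E p) →ₗ[K] (∀ p, E p)) (r : ι → α) (c : ι → K)
    (h : ∀ p u, (∀ q, r q < r p → u q = 0) → L u p = c p • u p) :
    LinearMap.det L = ∏ p, c p ^ Module.finrank K (E p) := by
  classical
  let B := Pi.basis fun p => Module.finBasis K (E p)
  have entry : ∀ s t, r s.1 ≤ r t.1 →
      LinearMap.toMatrix B B L s t = if s = t then c s.1 else 0 := by
    rintro ⟨p, a⟩ ⟨q, b⟩ hrs
    rw [LinearMap.toMatrix_apply, Pi.basis_repr, Pi.basis_apply]
    dsimp only at hrs ⊢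
    rw [h p _ fun q' hq' => Pi.single_eq_of_ne (by rintro rfl; exact hq'.not_ge hrs) _]
    by_cases hpq : p = q
    · subst hpq
      simp [Finsupp.single_apply, eq_comm]
    · simp [hpq]
  have triangular : (LinearMap.toMatrix B B L).BlockTriangular
      fun s => OrderDual.toDual (r s.1) := fun s t hst => by
    have hlt : r s.1 < r t.1 := hst
    rw [entry s t hlt.le, if_neg (by rintro rfl; exact lt_irrefl _ hlt)]
  rw [← LinearMap.det_toMatrix B, det_eq_prod_diag_of_blockTriangular triangular
    fun s t hst hne => by rw [entry s t (OrderDual.toDual.injective hst).le, if_neg hne]]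
  simp [entry, Fintype.prod_sigma]

end Determinants

section Laplace

open ProbabilityTheory Filter Topology

theorem eqOn_complexMGF_of_mgf_eventuallyEq {Ω Ω' : Type*} [MeasurableSpace Ω] [MeasurableSpace Ω']
    {μ : Measure Ω} {ν : Measure Ω'} {X : Ω → ℝ} {Y : Ω' → ℝ}
    (hX : 0 ∈ interior (integrableExpSet X μ)) (hY : 0 ∈ interior (integrableExpSet Y ν))
    (h : mgf X μ =ᶠ[𝓝 0] mgf Y ν) :
    Set.EqOn (complexMGF X μ) (complexMGF Y ν)
      {z | z.re ∈ interior (integrableExpSet X μ) ∩ interior (integrableExpSet Y ν)} := by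
  refine AnalyticOnNhd.eqOn_of_preconnected_of_frequently_eq (z₀ := 0)
    (analyticOnNhd_complexMGF.mono fun z hz => hz.1)
    (analyticOnNhd_complexMGF.mono fun z hz => hz.2)
    ((convex_integrableExpSet.interior.inter convex_integrableExpSet.interior).linear_preimage
      Complex.reLm).isPreconnected ⟨by simpa using hX, by simpa using hY⟩ ?_
  have hreal : ∀ᶠ t : ℝ in 𝓝[≠] 0, complexMGF X μ t = complexMGF Y ν t := by
    filter_upwards [h.filter_mono nhdsWithin_le_nhds] with t ht
    rw [complexMGF_ofReal, complexMGF_ofReal, ht]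
  have hmap : Tendsto ((↑) : ℝ → ℂ) (𝓝[≠] 0) (𝓝[≠] 0) := by
    refine tendsto_nhdsWithin_iff.2 ⟨?_, ?_⟩
    · exact (Complex.continuous_ofReal.tendsto' 0 0 Complex.ofReal_zero).mono_left
        nhdsWithin_le_nhds
    · filter_upwards [self_mem_nhdsWithin] with t ht using Complex.ofReal_ne_zero.2 ht
  exact hmap.frequently hreal.frequently

theorem ext_of_laplace_eventuallyEq {E : Type*} [NormedAddCommGroup E] [NormedSpace ℝ E]
    [MeasurableSpace E] [BorelSpace E] [SecondCountableTopology E] [CompleteSpace E]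
    {μ ν : Measure E} [IsFiniteMeasure μ] [IsFiniteMeasure ν]
    (h : ∀ L : StrongDual ℝ E, ∀ᶠ t : ℝ in 𝓝 0,
      ∫⁻ v, ENNReal.ofReal (Real.exp (t * L v)) ∂μ ≠ ⊤ ∧
      ∫⁻ v, ENNReal.ofReal (Real.exp (t * L v)) ∂μ =
        ∫⁻ v, ENNReal.ofReal (Real.exp (t * L v)) ∂ν) : μ = ν := by
  refine Measure.ext_of_charFunDual (funext fun L => ?_)
  have hmeas : ∀ (κ : Measure E) (t : ℝ), AEStronglyMeasurable (fun v => Real.exp (t * L v)) κ :=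
    fun κ t => by fun_prop
  have hpos : ∀ (κ : Measure E) (t : ℝ), 0 ≤ᵐ[κ] fun v => Real.exp (t * L v) :=
    fun κ t => Eventually.of_forall fun _ => (Real.exp_pos _).le
  have hμ : 0 ∈ interior (integrableExpSet L μ) := by
    rw [mem_interior_iff_mem_nhds]
    filter_upwards [h L] with t ht
    exact (lintegral_ofReal_ne_top_iff_integrable (hmeas μ t) (hpos μ t)).1 ht.1
  have hν : 0 ∈ interior (integrableExpSet L ν) := by
    rw [mem_interior_iff_mem_nhds]
    filter_upwards [h L] with t ht
    exact (lintegral_ofReal_ne_top_iff_integrable (hmeas ν t) (hpos ν t)).1 (ht.2 ▸ ht.1)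
  have hmgf : mgf L μ =ᶠ[𝓝 0] mgf L ν := by
    filter_upwards [h L] with t ht
    rw [mgf, mgf, integral_eq_lintegral_of_nonneg_ae (hpos μ t) (hmeas μ t), ht.2,
      integral_eq_lintegral_of_nonneg_ae (hpos ν t) (hmeas ν t)]
  have hI := eqOn_complexMGF_of_mgf_eventuallyEq hμ hν hmgf
    (x := Complex.I) ⟨by simpa using hμ, by simpa using hν⟩
  simpa only [complexMGF, charFunDual_apply, mul_comm Complex.I] using hI

theorem ext_of_laplace_of_isOpen {E : Type*} [NormedAddCommGroup E] [NormedSpace ℝ E]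
    [MeasurableSpace E] [BorelSpace E] [SecondCountableTopology E] [CompleteSpace E]
    {U : Set (StrongDual ℝ E)} (hU : IsOpen U) (hne : U.Nonempty) {μ ν : Measure E}
    (htop : ∀ L ∈ U, ∫⁻ v, ENNReal.ofReal (Real.exp (-L v)) ∂μ ≠ ⊤)
    (heq : ∀ L ∈ U, ∫⁻ v, ENNReal.ofReal (Real.exp (-L v)) ∂μ =
      ∫⁻ v, ENNReal.ofReal (Real.exp (-L v)) ∂ν) : μ = ν := by
  obtain ⟨L₀, hL₀⟩ := hne
  let f : E → ENNReal := fun v => ENNReal.ofReal (Real.exp (-L₀ v))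
  have hf : Measurable f := by fun_prop
  have tilt : ∀ (κ : Measure E) (L : StrongDual ℝ E) (t : ℝ),
      ∫⁻ v, ENNReal.ofReal (Real.exp (t * L v)) ∂κ.withDensity f =
        ∫⁻ v, ENNReal.ofReal (Real.exp (-(L₀ - t • L) v)) ∂κ := fun κ L t => by
    rw [lintegral_withDensity_eq_lintegral_mul _ hf (by fun_prop)]
    refine lintegral_congr fun v => ?_
    rw [Pi.mul_apply, ← ENNReal.ofReal_mul (Real.exp_pos _).le, ← Real.exp_add]
    simp only [sub_apply, smul_apply, smul_eq_mul]
    congr 2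
    ring
  have untilt : ∀ κ : Measure E, (κ.withDensity f).withDensity f⁻¹ = κ := fun κ =>
    withDensity_inv_same hf (.of_forall fun v => (ENNReal.ofReal_pos.2 (Real.exp_pos _)).ne')
      (.of_forall fun v => ENNReal.ofReal_ne_top)
  have : IsFiniteMeasure (μ.withDensity f) := isFiniteMeasure_withDensity (htop L₀ hL₀)
  have : IsFiniteMeasure (ν.withDensity f) :=
    isFiniteMeasure_withDensity (heq L₀ hL₀ ▸ htop L₀ hL₀)
  have hkey : μ.withDensity f = ν.withDensity f := by
    refine ext_of_laplace_eventuallyEq fun L => ?_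
    have hlim : Tendsto (fun t : ℝ => L₀ - t • L) (𝓝 0) (𝓝 L₀) :=
      Continuous.tendsto' (by fun_prop) _ _ (by simp)
    filter_upwards [hlim.eventually_mem (hU.mem_nhds hL₀)] with t ht
    rw [tilt, tilt]
    exact ⟨htop _ ht, heq _ ht⟩
  rw [← untilt μ, hkey, untilt]

end Laplace

section RelLeftInvariant

theorem exists_eq_smul_of_isMulLeftInvariant {G : Type*} [Group G] [MeasurableSpace G]
    [MeasurableMul₂ G] [MeasurableInv G] {m m' : Measure G} [SigmaFinite m] [SigmaFinite m']
    [m.IsMulLeftInvariant] [m'.IsMulLeftInvariant] (hne : m' ≠ 0) :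
    ∃ c : ENNReal, m = c • m' := by
  obtain ⟨n, hn⟩ : ∃ n, m' (spanningSets m' n) ≠ 0 := by
    by_contra! hall
    refine hne (Measure.measure_univ_eq_zero.1 ?_)
    rw [← iUnion_spanningSets m']
    exact measure_iUnion_null hall
  exact ⟨_, measure_eq_div_smul m m' hn (measure_spanningSets_lt_top _ n).ne⟩

/-- A measure on a group that is relatively invariant under left translation, with multiplier `δ`:
`∫ F(g x) m(dx) = δ(g)⁻¹ ∫ F(x) m(dx)`. For `δ = 1` this is left invariance. -/
def IsRelLeftInvariant {G : Type*} [Group G] [MeasurableSpace G] (δ : G →* ℝ) (m : Measure G) :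
    Prop :=
  ∀ g, m = ENNReal.ofReal (δ g) • m.map (g * ·)

namespace IsRelLeftInvariant

variable {G : Type*} [Group G] [MeasurableSpace G] {δ ε : G →* ℝ} {m m' : Measure G}

theorem lintegral_mul_left [MeasurableMul G] (hm : IsRelLeftInvariant δ m) (F : G → ENNReal)
    (g : G) : ∫⁻ h, F (g * h) ∂m = ENNReal.ofReal (δ g⁻¹) * ∫⁻ h, F h ∂m := by
  conv_lhs => rw [hm g⁻¹]
  rw [lintegral_smul_measure, smul_eq_mul, (measurableEmbedding_mulLeft g⁻¹).lintegral_map]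
  simp only [mul_inv_cancel_left]

theorem smul_measure [MeasurableMul G] (hm : IsRelLeftInvariant δ m) (c : ENNReal) :
    IsRelLeftInvariant δ (c • m) := fun g => by
  rw [Measure.map_smul, smul_comm, ← hm g]

theorem withDensity [MeasurableMul G] (hm : IsRelLeftInvariant δ m) (hε : Measurable ε)
    (hpos : ∀ g, 0 < ε g) :
    IsRelLeftInvariant (δ * ε) (m.withDensity fun g => ENNReal.ofReal (ε g)) := by
  intro g
  ext s hs
  have hs' : MeasurableSet ((g * ·) ⁻¹' s) := measurable_const_mul g hs
  rw [Measure.smul_apply, smul_eq_mul, Measure.map_apply (measurable_const_mul g) hs,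
    withDensity_apply _ hs, withDensity_apply _ hs']
  conv_lhs => rw [hm g]
  rw [Measure.restrict_smul, lintegral_smul_measure, smul_eq_mul,
    setLIntegral_map hs hε.ennreal_ofReal (measurable_const_mul g), MonoidHom.mul_apply,
    ENNReal.ofReal_mul' (hpos g).le, mul_assoc]
  congr 1
  simp only [map_mul, ENNReal.ofReal_mul (hpos g).le]
  exact lintegral_const_mul' _ _ ENNReal.ofReal_ne_top

theorem isMulLeftInvariant [MeasurableMul G] (hm : IsRelLeftInvariant 1 m) :
    m.IsMulLeftInvariant := by
  refine ⟨fun g => ?_⟩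
  conv_rhs => rw [hm g]
  simp

theorem exists_eq_smul [MeasurableMul₂ G] [MeasurableInv G] [SigmaFinite m] [SigmaFinite m']
    (hm : IsRelLeftInvariant δ m) (hm' : IsRelLeftInvariant δ m') (hδ : Measurable δ)
    (hpos : ∀ g, 0 < δ g) (hne : m' ≠ 0) : ∃ c : ENNReal, m = c • m' := by
  let ε : G →* ℝ := (invMonoidWithZeroHom (G₀ := ℝ) : ℝ →* ℝ).comp δ
  have hε : Measurable ε := hδ.inv
  have hεpos : ∀ g, 0 < ε g := fun g => inv_pos.2 (hpos g)
  have hδε : δ * ε = 1 := MonoidHom.ext fun g => mul_inv_cancel₀ (hpos g).ne'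
  let f : G → ENNReal := fun g => ENNReal.ofReal (ε g)
  have hf : Measurable f := hε.ennreal_ofReal
  have hf0 : ∀ g, f g ≠ 0 := fun g => (ENNReal.ofReal_pos.2 (hεpos g)).ne'
  have : (m.withDensity f).IsMulLeftInvariant :=
    (hδε ▸ hm.withDensity hε hεpos).isMulLeftInvariant
  have : (m'.withDensity f).IsMulLeftInvariant :=
    (hδε ▸ hm'.withDensity hε hεpos).isMulLeftInvariant
  have hf_top {κ : Measure G} : ∀ᵐ g ∂κ, f g ≠ ⊤ := .of_forall fun _ => ENNReal.ofReal_ne_top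
  have cancel (κ : Measure G) : (κ.withDensity f).withDensity f⁻¹ = κ :=
    withDensity_inv_same hf (.of_forall hf0) hf_top
  have := SigmaFinite.withDensity_of_ne_top (μ := m) hf_top
  have := SigmaFinite.withDensity_of_ne_top (μ := m') hf_top
  have hne' : m'.withDensity f ≠ 0 := fun h => hne (by rw [← cancel m', h, withDensity_zero_left])
  obtain ⟨c, hc⟩ := exists_eq_smul_of_isMulLeftInvariant (m := m.withDensity f) hne'
  exact ⟨c, by rw [← cancel m, hc, withDensity_smul_measure, cancel]⟩

end IsRelLeftInvariant

end RelLeftInvariant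

section Bilinear

variable {E F : Type*}

theorem injOn_bilin_self [AddCommGroup E] [Module ℝ E] [AddCommGroup F] [Module ℝ F]
    {B : E →ₗ[ℝ] E →ₗ[ℝ] F} {s : Set E} (hs : ∀ x ∈ s, ∀ y ∈ s, x + y ∈ s)
    (hB : ∀ x ∈ s, Function.Injective (B x + B.flip x)) : Set.InjOn (fun x => B x x) s := by
  intro x hx y hy hxy
  have polarization : (B (x + y) + B.flip (x + y)) (x - y) = 2 • (B x x - B y y) := by
    simp only [map_add, map_sub, LinearMap.add_apply, LinearMap.flip_apply]
    abel
  rw [sub_eq_zero.2 hxy, smul_zero] at polarization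
  exact sub_eq_zero.1 ((map_eq_zero_iff _ (hB _ (hs x hx y hy))).1 polarization)

theorem hasStrictFDerivAt_bilin_self [NormedAddCommGroup E] [NormedSpace ℝ E]
    [FiniteDimensional ℝ E] [NormedAddCommGroup F] [NormedSpace ℝ F]
    (B : E →ₗ[ℝ] E →ₗ[ℝ] F) (x : E) :
    HasStrictFDerivAt (fun v => B v v) (LinearMap.toContinuousLinearMap (B x + B.flip x)) x := by
  let C : E →L[ℝ] E →L[ℝ] F :=
    LinearMap.toContinuousLinearMap (LinearMap.toContinuousLinearMap.toLinearMap ∘ₗ B)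
  have h := C.isBoundedBilinearMap.hasStrictFDerivAt (x, x)
  refine (h.comp (f := fun v => (v, v)) x
    ((hasStrictFDerivAt_id x).prodMk (hasStrictFDerivAt_id x))).congr_fderiv ?_
  ext v
  simp [C]

theorem continuous_bilin_self [NormedAddCommGroup E] [NormedSpace ℝ E]
    [FiniteDimensional ℝ E] [NormedAddCommGroup F] [NormedSpace ℝ F]
    (B : E →ₗ[ℝ] E →ₗ[ℝ] F) : Continuous fun x => B x x :=
  continuous_iff_continuousAt.2 fun x => (hasStrictFDerivAt_bilin_self B x).continuousAt

theorem isOpen_image_bilin_self [NormedAddCommGroup E] [NormedSpace ℝ E]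
    [FiniteDimensional ℝ E] [NormedAddCommGroup F] [NormedSpace ℝ F] [CompleteSpace F]
    {B : E →ₗ[ℝ] E →ₗ[ℝ] F} {s : Set E} (hs : IsOpen s)
    (hB : ∀ x ∈ s, Function.Surjective (B x + B.flip x)) : IsOpen ((fun x => B x x) '' s) := by
  refine isOpen_iff_mem_nhds.2 ?_
  rintro _ ⟨x, hx, rfl⟩
  have := FiniteDimensional.complete ℝ E
  rw [← (hasStrictFDerivAt_bilin_self B x).map_nhds_eq_of_surj (LinearMap.range_eq_top.2 (hB x hx))]
  exact Filter.image_mem_map (hs.mem_nhds hx)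

end Bilinear

/-! ### Lower triangular matrices -/

section LowerEntries

/-- The positions of a lower triangular matrix. -/
abbrev LowerIndex (I : Type*) [PartialOrder I] : Type _ := {p : I × I // p.2 ≤ p.1}

/-- The space `∏_{j ≼ i} A i j` of the entries of a lower triangular matrix. Working in this
product rather than in the subset `𝒯_l` of `VinMat A` makes Lebesgue measure and determinants
available; `lowerExt` and `lowerRes` pass between the two. -/
abbrev LowerEntries {I : Type*} [PartialOrder I] (A : I → I → Type*) : Type _ :=
  ∀ p : LowerIndex I, A p.1.1 p.1.2

open Classical in
theorem prod_lowerIndex_eq_prod_row {I M : Type*} [Fintype I] [PartialOrder I] [CommMonoid M]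
    (F : I → I → M) :
    ∏ p : LowerIndex I, F p.1.1 p.1.2 = ∏ i, (F i i * ∏ j with j < i, F i j) := by
  rw [← Finset.prod_subtype (Finset.univ.filter fun p : I × I => p.2 ≤ p.1) (by simp)
    fun p => F p.1 p.2, Finset.prod_filter, ← Finset.univ_product_univ, Finset.prod_product]
  refine Finset.prod_congr rfl fun i _ => ?_
  rw [← Finset.prod_filter, ← Finset.prod_insert (s := Finset.univ.filter (· < i)) (by simp)]
  congr 1
  ext j
  simp [le_iff_eq_or_lt]

open Classical in
theorem prod_lowerIndex_eq_prod_col {I M : Type*} [Fintype I] [PartialOrder I] [CommMonoid M]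
    (F : I → I → M) :
    ∏ p : LowerIndex I, F p.1.1 p.1.2 = ∏ i, (F i i * ∏ m with i < m, F m i) := by
  rw [← Finset.prod_subtype (Finset.univ.filter fun p : I × I => p.2 ≤ p.1) (by simp)
    fun p => F p.1 p.2, Finset.prod_filter, ← Finset.univ_product_univ, Finset.prod_product_right]
  refine Finset.prod_congr rfl fun i _ => ?_
  rw [← Finset.prod_filter,
    ← Finset.prod_insert (s := Finset.univ.filter (i < ·)) (f := fun m => F m i) (by simp)]
  congr 1
  ext j
  simp [le_iff_eq_or_lt, eq_comm]

theorem toLinearExtension_strictMono {I : Type*} [PartialOrder I] :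
    StrictMono (toLinearExtension : I → LinearExtension I) :=
  toLinearExtension.monotone.strictMono_of_injective fun _ _ h => h

variable {I : Type*} [PartialOrder I] {A : I → I → Type*}
  [∀ i j, AddCommGroup (A i j)] [∀ i j, Module ℝ (A i j)]

open Classical in
/-- The lower triangular matrix with the given entries. -/
noncomputable def lowerExt : LowerEntries A →ₗ[ℝ] VinMat A where
  toFun x i j := if h : j ≤ i then x ⟨(i, j), h⟩ else 0
  map_add' x y := by
    ext i j
    by_cases h : j ≤ i <;> simp [h]
  map_smul' c x := by
    ext i j
    by_cases h : j ≤ i <;> simp [h]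

/-- The lower triangular entries of a matrix. -/
def lowerRes : VinMat A →ₗ[ℝ] LowerEntries A where
  toFun X p := X p.1.1 p.1.2
  map_add' _ _ := rfl
  map_smul' _ _ := rfl

theorem lowerExt_of_le (x : LowerEntries A) {i j : I} (h : j ≤ i) :
    lowerExt x i j = x ⟨(i, j), h⟩ :=
  dif_pos h

theorem lowerExt_of_not_le (x : LowerEntries A) {i j : I} (h : ¬ j ≤ i) : lowerExt x i j = 0 :=
  dif_neg h

theorem lowerRes_apply (X : VinMat A) (p : LowerIndex I) : lowerRes X p = X p.1.1 p.1.2 := rfl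

theorem lowerRes_lowerExt (x : LowerEntries A) : lowerRes (lowerExt x) = x :=
  funext fun p => lowerExt_of_le x p.2

theorem lowerExt_injective : Function.Injective (lowerExt : LowerEntries A →ₗ[ℝ] VinMat A) :=
  Function.LeftInverse.injective lowerRes_lowerExt

end LowerEntries

namespace VinbergAlgebra

open VinbergData

variable {I : Type*} [Fintype I] [PartialOrder I] {A : I → I → Type*}
  [∀ i j, NormedAddCommGroup (A i j)] [∀ i j, InnerProductSpace ℝ (A i j)] (V : VinbergAlgebra A)

/-! ### The algebra of lower triangular matrices -/

theorem one_apply_self (i : I) : V.one i i = (V.scal i).symm 1 := dif_pos rfl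

theorem one_apply_ne {i j : I} (h : i ≠ j) : V.one i j = 0 := dif_neg h

theorem diag_eq_smul (i : I) (a : A i i) : a = V.scal i a • (V.scal i).symm 1 :=
  (V.scal i).injective (by simp)

theorem emul_diag_left (i j : I) (a : A i i) (x : A i j) : V.emul i i j a x = V.scal i a • x := by
  classical
  have h := congrFun (congrFun (V.one_mul (Pi.single i (Pi.single j x))) i) j
  simp only [VinbergData.mul, Pi.single_eq_same] at h
  rw [Finset.sum_eq_single i (fun k _ hk => by rw [one_apply_ne V hk.symm]; simp) (by simp),
    one_apply_self] at h
  rw [V.diag_eq_smul i a]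
  simpa using congrArg (V.scal i a • ·) h

theorem emul_diag_right (i j : I) (x : A i j) (a : A j j) :
    V.emul i j j x a = V.scal j a • x := by
  classical
  have h := congrFun (congrFun (V.mul_one (Pi.single i (Pi.single j x))) i) j
  simp only [VinbergData.mul, Pi.single_eq_same] at h
  rw [Finset.sum_eq_single j (fun k _ hk => by rw [one_apply_ne V hk]; simp) (by simp),
    one_apply_self] at h
  rw [V.diag_eq_smul j a]
  simpa using congrArg (V.scal j a • ·) h

theorem eadj_diag (i : I) (a : A i i) : V.eadj i i a = a :=
  (V.scal i).injective (V.scal_eadj i a)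

theorem norm_diag (i : I) (a : A i i) : ‖a‖ = |V.scal i a| := by
  have h := V.norm_sq_eq i i a
  rw [eadj_diag, emul_diag_left, map_smul, smul_eq_mul, ← sq] at h
  rw [← abs_norm]
  exact (sq_eq_sq_iff_abs_eq_abs _ _).1 h

theorem finrank_diag (V : VinbergAlgebra A) (i : I) : Module.finrank ℝ (A i i) = 1 := by
  rw [(V.scal i).finrank_eq, Module.finrank_self]

theorem tr_mul_adj (X : VinMat A) : V.tr (V.mul X (V.adj X)) = ∑ i, ∑ j, ‖X i j‖ ^ 2 := by
  simp only [VinbergData.tr, VinbergData.mul, VinbergData.adj, map_sum, V.norm_sq_eq]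

/-- The multiplication as a bilinear map. -/
noncomputable def mulBilin : VinMat A →ₗ[ℝ] VinMat A →ₗ[ℝ] VinMat A :=
  LinearMap.mk₂ ℝ V.mul
    (fun X Y Z => by ext; simp [VinbergData.mul, Finset.sum_add_distrib])
    (fun c X Y => by ext; simp [VinbergData.mul, Finset.smul_sum])
    (fun X Y Z => by ext; simp [VinbergData.mul, Finset.sum_add_distrib])
    (fun c X Y => by ext; simp [VinbergData.mul, Finset.smul_sum])

/-- The involution as a linear map. -/
def adjLin : VinMat A →ₗ[ℝ] VinMat A where
  toFun := V.adj
  map_add' X Y := by ext; simp [VinbergData.adj]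
  map_smul' c X := by ext; simp [VinbergData.adj]

/-- The trace as a linear map. -/
noncomputable def trLin : VinMat A →ₗ[ℝ] ℝ where
  toFun := V.tr
  map_add' X Y := by simp [VinbergData.tr, Finset.sum_add_distrib]
  map_smul' c X := by simp [VinbergData.tr, Finset.mul_sum]

theorem adj_adj (X : VinMat A) : V.adj (V.adj X) = X := by
  ext i j
  simp [VinbergData.adj, V.eadj_eadj]

theorem mem_herm {X : VinMat A} : X ∈ V.herm ↔ V.adj X = X := Iff.rfl

theorem mul_adj_mem_herm (X : VinMat A) : V.mul X (V.adj X) ∈ V.herm := by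
  rw [mem_herm, V.adj_mul, adj_adj]

theorem adj_mul_mem_herm (X : VinMat A) : V.mul (V.adj X) X ∈ V.herm := by
  rw [mem_herm, V.adj_mul, adj_adj]

theorem one_mem_lower : V.one ∈ V.lower := fun _ _ h => V.one_apply_ne fun e => h e.ge

theorem mul_mem_lower {X Y : VinMat A} (hX : X ∈ V.lower) (hY : Y ∈ V.lower) :
    V.mul X Y ∈ V.lower := by
  intro i k hk
  refine Finset.sum_eq_zero fun j _ => ?_
  by_cases hj : j ≤ i
  · rw [hY j k fun h => hk (h.trans hj), map_zero]
  · rw [hX i j hj, map_zero, LinearMap.zero_apply]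

theorem scal_mul_diag {X Y : VinMat A} (hX : X ∈ V.lower) (hY : Y ∈ V.lower) (i : I) :
    V.scal i (V.mul X Y i i) = V.scal i (X i i) * V.scal i (Y i i) := by
  rw [VinbergData.mul, Finset.sum_eq_single i, emul_diag_left, map_smul, smul_eq_mul]
  · intro j _ hj
    by_cases h : j ≤ i
    · rw [hY j i fun h' => hj (le_antisymm h h'), map_zero]
    · rw [hX i j h, map_zero, LinearMap.zero_apply]
  · simp

theorem tr_adj_mul_mul_mul_adj {Q W : VinMat A} (hQ : Q ∈ V.lower) (hW : W ∈ V.lower) :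
    V.tr (V.mul (V.mul (V.adj Q) Q) (V.mul W (V.adj W))) =
      V.tr (V.mul (V.mul Q W) (V.adj (V.mul Q W))) := by
  rw [← V.tr_assoc, V.lower_adj_assoc Q hQ W hW, V.tr_comm, ← V.tr_assoc, ← V.adj_mul]

theorem lowerExt_mem_lower (x : LowerEntries A) : lowerExt x ∈ V.lower :=
  fun _ _ h => lowerExt_of_not_le x h

theorem lowerExt_lowerRes {X : VinMat A} (hX : X ∈ V.lower) : lowerExt (lowerRes X) = X := by
  ext i j
  by_cases h : j ≤ i
  · exact lowerExt_of_le _ h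
  · rw [lowerExt_of_not_le _ h, hX i j h]

/-- The diagonal entries as real numbers. -/
def diagEntry (i : I) : LowerEntries A →ₗ[ℝ] ℝ :=
  (V.scal i).toLinearMap ∘ₗ LinearMap.proj (⟨(i, i), le_rfl⟩ : LowerIndex I)

theorem diagEntry_apply (i : I) (x : LowerEntries A) :
    V.diagEntry i x = V.scal i (x ⟨(i, i), le_rfl⟩) := rfl

theorem scal_lowerExt (i : I) (x : LowerEntries A) :
    V.scal i (lowerExt x i i) = V.diagEntry i x := by
  rw [lowerExt_of_le x le_rfl, diagEntry_apply]

theorem diagEntry_smul_comm (i : I) (x y : LowerEntries A) :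
    V.diagEntry i x • y ⟨(i, i), le_rfl⟩ = V.diagEntry i y • x ⟨(i, i), le_rfl⟩ :=
  (V.scal i).injective (by simp [diagEntry_apply, mul_comm])

/-- The product of lower triangular matrices, on entries. -/
noncomputable def lowerMul : LowerEntries A →ₗ[ℝ] LowerEntries A →ₗ[ℝ] LowerEntries A :=
  (V.mulBilin.compl₁₂ lowerExt lowerExt).compr₂ lowerRes

theorem lowerMul_apply (x y : LowerEntries A) :
    V.lowerMul x y = lowerRes (V.mul (lowerExt x) (lowerExt y)) := rfl

theorem lowerExt_lowerMul (x y : LowerEntries A) :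
    lowerExt (V.lowerMul x y) = V.mul (lowerExt x) (lowerExt y) :=
  V.lowerExt_lowerRes (V.mul_mem_lower (V.lowerExt_mem_lower x) (V.lowerExt_mem_lower y))

theorem diagEntry_lowerMul (i : I) (x y : LowerEntries A) :
    V.diagEntry i (V.lowerMul x y) = V.diagEntry i x * V.diagEntry i y := by
  rw [← scal_lowerExt, lowerExt_lowerMul,
    scal_mul_diag V (V.lowerExt_mem_lower x) (V.lowerExt_mem_lower y), scal_lowerExt, scal_lowerExt]

/-- The unit matrix, as a lower triangular matrix. -/
noncomputable def lowerOne : LowerEntries A := lowerRes V.one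

theorem lowerExt_lowerOne : lowerExt V.lowerOne = V.one := V.lowerExt_lowerRes V.one_mem_lower

theorem diagEntry_lowerOne (i : I) : V.diagEntry i V.lowerOne = 1 := by
  rw [← scal_lowerExt, lowerExt_lowerOne, one_apply_self, LinearEquiv.apply_symm_apply]

theorem lowerMul_assoc (x y z : LowerEntries A) :
    V.lowerMul (V.lowerMul x y) z = V.lowerMul x (V.lowerMul y z) := by
  apply lowerExt_injective
  simp only [lowerExt_lowerMul]
  exact V.lower_assoc _ (V.lowerExt_mem_lower x) _ (V.lowerExt_mem_lower y) _
    (V.lowerExt_mem_lower z)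

theorem lowerMul_lowerOne (x : LowerEntries A) : V.lowerMul x V.lowerOne = x := by
  apply lowerExt_injective
  rw [lowerExt_lowerMul, lowerExt_lowerOne, V.mul_one]

theorem lowerOne_lowerMul (x : LowerEntries A) : V.lowerMul V.lowerOne x = x := by
  apply lowerExt_injective
  rw [lowerExt_lowerMul, lowerExt_lowerOne, V.one_mul]

/-- `tr (T T^*)`, the sum of the squares of the norms of the entries of `T`. -/
noncomputable def sqNorm (x : LowerEntries A) : ℝ := V.tr (V.mul (lowerExt x) (V.adj (lowerExt x)))

open Classical in
theorem sqNorm_eq (x : LowerEntries A) : V.sqNorm x = ∑ p, ‖x p‖ ^ 2 := by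
  rw [sqNorm, tr_mul_adj, ← Finset.sum_product', Finset.univ_product_univ,
    ← Fintype.sum_subtype_add_sum_subtype (fun p : I × I => p.2 ≤ p.1)]
  have h2 : ∑ p : {p : I × I // ¬ p.2 ≤ p.1}, ‖lowerExt x p.1.1 p.1.2‖ ^ 2 = 0 :=
    Finset.sum_eq_zero fun p _ => by rw [lowerExt_of_not_le x p.2]; simp
  rw [h2, add_zero]
  exact Finset.sum_congr rfl fun p _ => by rw [lowerExt_of_le x p.2]

theorem continuous_sqNorm : Continuous V.sqNorm := by
  classical
  simp only [funext V.sqNorm_eq]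
  fun_prop

/-- The Hermitian matrix `T T^*` of a lower triangular matrix `T`. -/
noncomputable def hermSq (x : LowerEntries A) : V.herm :=
  ⟨V.mul (lowerExt x) (V.adj (lowerExt x)), V.mul_adj_mem_herm _⟩

/-- The Hermitian matrix `T^* T` of a lower triangular matrix `T`. -/
noncomputable def dualSq (x : LowerEntries A) : V.herm :=
  ⟨V.mul (V.adj (lowerExt x)) (lowerExt x), V.adj_mul_mem_herm _⟩

theorem coe_hermSq (x : LowerEntries A) :
    (V.hermSq x : VinMat A) = V.mul (lowerExt x) (V.adj (lowerExt x)) := rfl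

theorem tr_dualSq_mul_hermSq (q w : LowerEntries A) :
    V.tr (V.mul (V.dualSq q) (V.hermSq w)) = V.sqNorm (V.lowerMul q w) := by
  rw [sqNorm, lowerExt_lowerMul]
  exact V.tr_adj_mul_mul_mul_adj (V.lowerExt_mem_lower q) (V.lowerExt_mem_lower w)

/-- The lower triangular entries of `S T^*`: the bilinear map whose quadratic map is `hermSq`. -/
noncomputable def sqBilin : LowerEntries A →ₗ[ℝ] LowerEntries A →ₗ[ℝ] LowerEntries A :=
  (V.mulBilin.compl₁₂ lowerExt (V.adjLin ∘ₗ lowerExt)).compr₂ lowerRes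

theorem sqBilin_apply (x y : LowerEntries A) :
    V.sqBilin x y = lowerRes (V.mul (lowerExt x) (V.adj (lowerExt y))) := rfl

/-- The lower triangular entries of `S^* T`: the bilinear map whose quadratic map is `dualSq`. -/
noncomputable def dualBilin : LowerEntries A →ₗ[ℝ] LowerEntries A →ₗ[ℝ] LowerEntries A :=
  (V.mulBilin.compl₁₂ (V.adjLin ∘ₗ lowerExt) lowerExt).compr₂ lowerRes

theorem dualBilin_apply (x y : LowerEntries A) :
    V.dualBilin x y = lowerRes (V.mul (V.adj (lowerExt x)) (lowerExt y)) := rfl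

theorem lowerMul_apply_of_forall_lt (x : LowerEntries A) {u : LowerEntries A} {i j : I}
    (hij : j ≤ i) (hu : ∀ k (hjk : j ≤ k), k < i → u ⟨(k, j), hjk⟩ = 0) :
    V.lowerMul x u ⟨(i, j), hij⟩ = V.diagEntry i x • u ⟨(i, j), hij⟩ := by
  rw [lowerMul_apply, lowerRes_apply]
  dsimp only [VinbergData.mul]
  rw [Finset.sum_eq_single i, emul_diag_left, scal_lowerExt, lowerExt_of_le u hij]
  · intro k _ hk
    by_cases hki : k ≤ i
    · by_cases hjk : j ≤ k
      · rw [lowerExt_of_le u hjk, hu k hjk (hki.lt_of_ne hk), map_zero]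
      · rw [lowerExt_of_not_le u hjk, map_zero]
    · rw [lowerExt_of_not_le x hki, map_zero, LinearMap.zero_apply]
  · simp

theorem sqBilin_apply_of_forall_lt {x y : LowerEntries A} {i j : I} (hij : j ≤ i)
    (h : ∀ k (hkj : k < j), x ⟨(i, k), hkj.le.trans hij⟩ = 0 ∨ y ⟨(j, k), hkj.le⟩ = 0) :
    V.sqBilin x y ⟨(i, j), hij⟩ = V.diagEntry j y • x ⟨(i, j), hij⟩ := by
  rw [sqBilin_apply, lowerRes_apply]
  dsimp only [VinbergData.mul, VinbergData.adj]
  rw [Finset.sum_eq_single j, eadj_diag, emul_diag_right, scal_lowerExt, lowerExt_of_le x hij]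
  · intro k _ hk
    by_cases hkj : k ≤ j
    · rw [lowerExt_of_le x (hkj.trans hij), lowerExt_of_le y hkj]
      rcases h k (hkj.lt_of_ne hk) with h | h <;> simp [h]
    · rw [lowerExt_of_not_le y hkj, map_zero, map_zero]
  · simp

theorem dualBilin_apply_of_forall_lt {x y : LowerEntries A} {i j : I} (hij : j ≤ i)
    (h : ∀ k (hik : i < k), x ⟨(k, i), hik.le⟩ = 0 ∨ y ⟨(k, j), hij.trans hik.le⟩ = 0) :
    V.dualBilin x y ⟨(i, j), hij⟩ = V.diagEntry i x • y ⟨(i, j), hij⟩ := by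
  rw [dualBilin_apply, lowerRes_apply]
  dsimp only [VinbergData.mul, VinbergData.adj]
  rw [Finset.sum_eq_single i, eadj_diag, emul_diag_left, scal_lowerExt, lowerExt_of_le y hij]
  · intro k _ hk
    by_cases hik : i ≤ k
    · rw [lowerExt_of_le x hik, lowerExt_of_le y (hij.trans hik)]
      rcases h k (hik.lt_of_ne' hk) with h | h <;> simp [h]
    · rw [lowerExt_of_not_le x hik, map_zero, map_zero, LinearMap.zero_apply]
  · simp

section Determinants

variable [∀ i j, FiniteDimensional ℝ (A i j)]

theorem det_lowerMul (x : LowerEntries A) :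
    LinearMap.det (V.lowerMul x) = ∏ i, V.diagEntry i x ^ (1 + V.nRow i) := by
  classical
  rw [det_pi_of_triangular (V.lowerMul x) (fun p => toLinearExtension p.1.1)
    (fun p => V.diagEntry p.1.1 x) fun p u hu => V.lowerMul_apply_of_forall_lt x p.2
      fun k hjk hk => hu ⟨(k, p.1.2), hjk⟩ (toLinearExtension_strictMono hk),
    prod_lowerIndex_eq_prod_row fun i j => V.diagEntry i x ^ Module.finrank ℝ (A i j)]
  refine Finset.prod_congr rfl fun i _ => ?_
  rw [Finset.prod_pow_eq_pow_sum, V.finrank_diag, ← pow_add, nRow]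

theorem det_sqBilin_add_flip (x : LowerEntries A) :
    LinearMap.det (V.sqBilin x + V.sqBilin.flip x) =
      ∏ i, 2 * V.diagEntry i x ^ (1 + V.nCol i) := by
  classical
  rw [det_pi_of_triangular (V.sqBilin x + V.sqBilin.flip x)
    (fun p => toLex (toLinearExtension p.1.2, toLinearExtension p.1.1))
    (fun p => (if p.1.1 = p.1.2 then 2 else 1) * V.diagEntry p.1.2 x),
    prod_lowerIndex_eq_prod_col fun i j =>
      ((if i = j then 2 else 1) * V.diagEntry j x) ^ Module.finrank ℝ (A i j)]
  · refine Finset.prod_congr rfl fun i _ => ?_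
    rw [if_pos rfl, V.finrank_diag, pow_one, pow_add, pow_one, mul_assoc, nCol,
      ← Finset.prod_pow_eq_pow_sum]
    congr! 4 with m hm
    rw [if_neg (Finset.mem_filter.1 hm).2.ne', _root_.one_mul]
  · rintro ⟨⟨i, j⟩, (hij : j ≤ i)⟩ u hu
    have hcol : ∀ k l (hkl : k ≤ l), k < j → u ⟨(l, k), hkl⟩ = 0 := fun k l hkl hk =>
      hu _ (Prod.Lex.toLex_lt_toLex.2 (Or.inl (toLinearExtension_strictMono hk)))
    rw [LinearMap.add_apply, Pi.add_apply, LinearMap.flip_apply,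
      V.sqBilin_apply_of_forall_lt hij fun k hk => Or.inr (hcol k j hk.le hk),
      V.sqBilin_apply_of_forall_lt hij fun k hk => Or.inl (hcol k i _ hk)]
    rcases hij.eq_or_lt with rfl | hlt
    · rw [V.diagEntry_smul_comm j u x, if_pos rfl, mul_smul, two_smul]
    · have hdiag : u ⟨(j, j), le_rfl⟩ = 0 :=
        hu _ (Prod.Lex.toLex_lt_toLex.2 (Or.inr ⟨rfl, toLinearExtension_strictMono hlt⟩))
      rw [V.diagEntry_apply j u, hdiag, map_zero, zero_smul, zero_add, if_neg hlt.ne',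
        _root_.one_mul]

theorem det_dualBilin_add_flip_ne_zero {x : LowerEntries A} (hx : ∀ i, V.diagEntry i x ≠ 0) :
    LinearMap.det (V.dualBilin x + V.dualBilin.flip x) ≠ 0 := by
  classical
  rw [det_pi_of_triangular (V.dualBilin x + V.dualBilin.flip x)
    (fun p => toLex (OrderDual.toDual (toLinearExtension p.1.1),
      OrderDual.toDual (toLinearExtension p.1.2)))
    (fun p => (if p.1.1 = p.1.2 then 2 else 1) * V.diagEntry p.1.1 x)]
  · exact Finset.prod_ne_zero_iff.2 fun p _ =>
      pow_ne_zero _ (mul_ne_zero (by split_ifs <;> norm_num) (hx p.1.1))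
  · rintro ⟨⟨i, j⟩, (hij : j ≤ i)⟩ u hu
    have hrow : ∀ k l (hlk : l ≤ k), i < k → u ⟨(k, l), hlk⟩ = 0 := fun k l hlk hk =>
      hu _ (Prod.Lex.toLex_lt_toLex.2
        (Or.inl (OrderDual.toDual_lt_toDual.2 (toLinearExtension_strictMono hk))))
    rw [LinearMap.add_apply, Pi.add_apply, LinearMap.flip_apply,
      V.dualBilin_apply_of_forall_lt hij fun k hk => Or.inr (hrow k j _ hk),
      V.dualBilin_apply_of_forall_lt hij fun k hk => Or.inl (hrow k i hk.le hk)]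
    rcases hij.eq_or_lt with rfl | hlt
    · rw [V.diagEntry_smul_comm j u x, if_pos rfl, mul_smul, two_smul]
    · have hdiag : u ⟨(i, i), le_rfl⟩ = 0 := hu _ (Prod.Lex.toLex_lt_toLex.2
        (Or.inr ⟨rfl, OrderDual.toDual_lt_toDual.2 (toLinearExtension_strictMono hlt)⟩))
      rw [V.diagEntry_apply i u, hdiag, map_zero, zero_smul, add_zero, if_neg hlt.ne',
        _root_.one_mul]

end Determinants

section GammaCone

theorem sum_nCol : ∑ i, V.nCol i = ∑ i, V.nRow i := by
  simp only [nCol, nRow]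
  exact Finset.sum_comm' (by simp)

theorem nTot_sub_card : V.nTot - Fintype.card I = ((∑ i, V.nRow i : ℕ) : ℝ) := by
  have h : ((∑ i, V.nCol i : ℕ) : ℝ) = ((∑ i, V.nRow i : ℕ) : ℝ) := by rw [sum_nCol]
  simp only [nTot, nVal, Finset.sum_add_distrib, Finset.sum_const, Finset.card_univ, nsmul_eq_mul,
    _root_.mul_one, ← Finset.sum_div]
  push_cast at h ⊢
  rw [h]
  ring

theorem gammaCone_pos {χ : I → ℝ} (hχ : ∀ i, (V.nRow i : ℝ) / 2 < χ i) : 0 < V.gammaCone χ :=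
  mul_pos (Real.rpow_pos_of_pos Real.pi_pos _)
    (Finset.prod_pos fun i _ => Real.Gamma_pos_of_pos (sub_pos.2 (hχ i)))

end GammaCone

variable [∀ i j, FiniteDimensional ℝ (A i j)]

section Coordinates

omit [∀ i j, FiniteDimensional ℝ (A i j)]

theorem lowerRes_injOn_herm : Set.InjOn (lowerRes : VinMat A → LowerEntries A) V.herm := by
  intro X hX Y hY hXY
  have hlow : ∀ i j, j ≤ i → X i j = Y i j := fun i j h => congrFun hXY ⟨(i, j), h⟩
  ext i j
  by_cases h : j ≤ i
  · exact hlow i j h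
  by_cases h' : i ≤ j
  · rw [← V.mem_herm.1 hX, ← V.mem_herm.1 hY]
    exact congrArg (V.eadj j i) (hlow j i h')
  · have := V.subsingleton_of_incomp i j h' h
    exact Subsingleton.elim _ _

open Classical in
theorem exists_mem_herm_lowerRes_eq (x : LowerEntries A) : ∃ X ∈ V.herm, lowerRes X = x := by
  refine ⟨fun i j => if h : j ≤ i then x ⟨(i, j), h⟩ else
    if h' : i ≤ j then V.eadj j i (x ⟨(j, i), h'⟩) else 0, ?_, funext fun p => dif_pos p.2⟩
  rw [mem_herm]
  ext i j
  simp only [VinbergData.adj]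
  by_cases h : j ≤ i
  · by_cases h' : i ≤ j
    · obtain rfl := le_antisymm h h'
      simp [eadj_diag]
    · simp [h, h', V.eadj_eadj]
  · by_cases h' : i ≤ j <;> simp [h, h']

/-- The lower triangular entries as linear coordinates on `ℋ`. -/
noncomputable def coordsEquiv : V.herm ≃ₗ[ℝ] LowerEntries A :=
  LinearEquiv.ofBijective (lowerRes ∘ₗ V.herm.subtype)
    ⟨fun X Y h => Subtype.ext (V.lowerRes_injOn_herm X.2 Y.2 h), fun x =>
      let ⟨X, hX, h⟩ := V.exists_mem_herm_lowerRes_eq x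
      ⟨⟨X, hX⟩, h⟩⟩

theorem coordsEquiv_hermSq (x : LowerEntries A) : V.coordsEquiv (V.hermSq x) = V.sqBilin x x := rfl

theorem coordsEquiv_dualSq (x : LowerEntries A) :
    V.coordsEquiv (V.dualSq x) = V.dualBilin x x := rfl

end Coordinates

/-! ### The group of lower triangular matrices with positive diagonal -/

/-- The entries of the matrices in `𝒯_l^+`. -/
def posLower : Set (LowerEntries A) := {x | ∀ i, 0 < V.diagEntry i x}

section PosLower

omit [∀ i j, FiniteDimensional ℝ (A i j)]

theorem lowerPos_eq_image : V.lowerPos = lowerExt '' V.posLower := by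
  ext T
  constructor
  · rintro ⟨hT, hpos⟩
    refine ⟨lowerRes T, fun i => ?_, V.lowerExt_lowerRes hT⟩
    rw [← scal_lowerExt, V.lowerExt_lowerRes hT]
    exact hpos i
  · rintro ⟨x, hx, rfl⟩
    exact ⟨V.lowerExt_mem_lower x, fun i => by rw [scal_lowerExt]; exact hx i⟩

theorem cone_eq_image : V.cone = V.hermSq '' V.posLower := by
  ext Z
  simp only [cone, lowerPos_eq_image, Set.mem_ofPred_eq, Set.mem_image, exists_exists_and_eq_and,
    Subtype.ext_iff, coe_hermSq]

theorem add_mem_posLower {x y : LowerEntries A} (hx : x ∈ V.posLower) (hy : y ∈ V.posLower) :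
    x + y ∈ V.posLower := fun i => by
  rw [map_add]
  exact add_pos (hx i) (hy i)

theorem lowerMul_mem_posLower {x y : LowerEntries A} (hx : x ∈ V.posLower)
    (hy : y ∈ V.posLower) : V.lowerMul x y ∈ V.posLower := fun i => by
  rw [diagEntry_lowerMul]
  exact mul_pos (hx i) (hy i)

theorem lowerOne_mem_posLower : V.lowerOne ∈ V.posLower := fun i => by
  rw [diagEntry_lowerOne]
  exact one_pos

end PosLower

theorem det_lowerMul_pos {x : LowerEntries A} (hx : x ∈ V.posLower) :
    0 < LinearMap.det (V.lowerMul x) := by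
  rw [det_lowerMul]
  exact Finset.prod_pos fun i _ => pow_pos (hx i) _

theorem det_sqBilin_add_flip_pos {x : LowerEntries A} (hx : x ∈ V.posLower) :
    0 < LinearMap.det (V.sqBilin x + V.sqBilin.flip x) := by
  rw [det_sqBilin_add_flip]
  exact Finset.prod_pos fun i _ => mul_pos two_pos (pow_pos (hx i) _)

theorem hermSq_injOn : Set.InjOn V.hermSq V.posLower := fun _ hx _ hy h =>
  injOn_bilin_self (B := V.sqBilin) (fun _ hx _ hy => V.add_mem_posLower hx hy)
    (fun _ hx => (LinearMap.equivOfDetNeZero _ (V.det_sqBilin_add_flip_pos hx).ne').injective)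
    hx hy (congrArg V.coordsEquiv h)

theorem dualSq_injOn : Set.InjOn V.dualSq V.posLower := fun _ hx _ hy h =>
  injOn_bilin_self (B := V.dualBilin) (fun _ hx _ hy => V.add_mem_posLower hx hy)
    (fun _ hx => (LinearMap.equivOfDetNeZero _
      (V.det_dualBilin_add_flip_ne_zero fun i => (hx i).ne')).injective)
    hx hy (congrArg V.coordsEquiv h)

theorem factor_hermSq {x : LowerEntries A} (hx : x ∈ V.posLower) :
    V.factor (V.hermSq x) = lowerExt x := by
  have h : V.factor (V.hermSq x) ∈ V.lowerPos ∧
      V.mul (V.factor (V.hermSq x)) (V.adj (V.factor (V.hermSq x))) = V.hermSq x :=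
    Classical.epsilon_spec (p := fun T => T ∈ V.lowerPos ∧ V.mul T (V.adj T) = V.hermSq x)
      ⟨lowerExt x, V.lowerPos_eq_image ▸ Set.mem_image_of_mem _ hx, rfl⟩
  obtain ⟨y, hy, he⟩ := V.lowerPos_eq_image ▸ h.1
  rw [← he] at h ⊢
  rw [V.hermSq_injOn hy hx (Subtype.ext h.2)]

theorem dualFactor_dualSq {x : LowerEntries A} (hx : x ∈ V.posLower) :
    V.dualFactor (V.dualSq x) = lowerExt x := by
  have h : V.dualFactor (V.dualSq x) ∈ V.lowerPos ∧
      V.mul (V.adj (V.dualFactor (V.dualSq x))) (V.dualFactor (V.dualSq x)) = V.dualSq x :=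
    Classical.epsilon_spec (p := fun T => T ∈ V.lowerPos ∧ V.mul (V.adj T) T = V.dualSq x)
      ⟨lowerExt x, V.lowerPos_eq_image ▸ Set.mem_image_of_mem _ hx, rfl⟩
  obtain ⟨y, hy, he⟩ := V.lowerPos_eq_image ▸ h.1
  rw [← he] at h ⊢
  rw [V.dualSq_injOn hy hx (Subtype.ext h.2)]

theorem exists_lowerMul_eq_lowerOne {x : LowerEntries A} (hx : x ∈ V.posLower) :
    ∃ y ∈ V.posLower, V.lowerMul x y = V.lowerOne := by
  obtain ⟨y, hy⟩ :=
    (LinearMap.equivOfDetNeZero _ (V.det_lowerMul_pos hx).ne').surjective V.lowerOne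
  have hy' : V.lowerMul x y = V.lowerOne := hy
  refine ⟨y, fun i => ?_, hy'⟩
  have h := V.diagEntry_lowerMul i x y
  rw [hy', diagEntry_lowerOne] at h
  exact (pos_iff_pos_of_mul_pos (h ▸ one_pos)).1 (hx i)

/-- The group structure of `𝒯_l^+`. -/
noncomputable instance : Group V.posLower :=
  letI : Mul V.posLower := ⟨fun x y => ⟨V.lowerMul x y, V.lowerMul_mem_posLower x.2 y.2⟩⟩
  letI : One V.posLower := ⟨⟨V.lowerOne, V.lowerOne_mem_posLower⟩⟩
  letI : Inv V.posLower := ⟨fun x => ⟨(V.exists_lowerMul_eq_lowerOne x.2).choose,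
    (V.exists_lowerMul_eq_lowerOne x.2).choose_spec.1⟩⟩
  Group.ofRightAxioms (fun x y z => Subtype.ext (V.lowerMul_assoc x y z))
    (fun x => Subtype.ext (V.lowerMul_lowerOne x))
    (fun x => Subtype.ext (V.exists_lowerMul_eq_lowerOne x.2).choose_spec.2)

theorem coe_mul (g h : V.posLower) :
    ((g * h : V.posLower) : LowerEntries A) = V.lowerMul g h := rfl

theorem coe_one : ((1 : V.posLower) : LowerEntries A) = V.lowerOne := rfl

theorem lowerExt_mul (g h : V.posLower) :
    lowerExt ((g * h : V.posLower) : LowerEntries A) =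
      V.mul (lowerExt (g : LowerEntries A)) (lowerExt (h : LowerEntries A)) :=
  V.lowerExt_lowerMul g h

theorem lowerExt_one : lowerExt ((1 : V.posLower) : LowerEntries A) = V.one := V.lowerExt_lowerOne

theorem lowerInv_lowerExt (g : V.posLower) :
    V.lowerInv (lowerExt (g : LowerEntries A)) =
      lowerExt ((g⁻¹ : V.posLower) : LowerEntries A) := by
  have h : V.lowerInv (lowerExt (g : LowerEntries A)) ∈ V.lowerPos ∧
      V.mul (lowerExt (g : LowerEntries A)) (V.lowerInv (lowerExt (g : LowerEntries A))) =
        V.one ∧ _ :=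
    Classical.epsilon_spec (p := fun S => S ∈ V.lowerPos ∧
      V.mul (lowerExt (g : LowerEntries A)) S = V.one ∧
      V.mul S (lowerExt (g : LowerEntries A)) = V.one)
    ⟨lowerExt ((g⁻¹ : V.posLower) : LowerEntries A),
      V.lowerPos_eq_image ▸ Set.mem_image_of_mem _ (g⁻¹).2,
      by rw [← lowerExt_mul, mul_inv_cancel, lowerExt_one],
      by rw [← lowerExt_mul, inv_mul_cancel, lowerExt_one]⟩
  obtain ⟨s, hs, he⟩ := V.lowerPos_eq_image ▸ h.1
  rw [← he] at h ⊢
  have hgs : g * ⟨s, hs⟩ = 1 := Subtype.ext <| lowerExt_injective <| by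
    rw [lowerExt_mul, lowerExt_one]
    exact h.2.1
  rw [← eq_inv_of_mul_eq_one_right hgs]

theorem dualInv_dualSq (g : V.posLower) :
    V.dualInv (V.dualSq (g : LowerEntries A)) =
      V.hermSq ((g⁻¹ : V.posLower) : LowerEntries A) := by
  rw [dualInv, V.dualFactor_dualSq g.2, lowerInv_lowerExt, coe_hermSq]

/-- The character `T ↦ ∏ t_{ii}^{2 λ_i}` of `𝒯_l^+`, that is `T ↦ Δ_χ(T T^*)`. -/
noncomputable def character (χ : I → ℝ) : V.posLower →* ℝ where
  toFun g := ∏ i, (V.diagEntry i g ^ 2) ^ χ i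
  map_one' := by simp [coe_one, diagEntry_lowerOne]
  map_mul' g h := by
    rw [← Finset.prod_mul_distrib]
    refine Finset.prod_congr rfl fun i _ => ?_
    rw [coe_mul, diagEntry_lowerMul, mul_pow, Real.mul_rpow (sq_nonneg _) (sq_nonneg _)]

theorem character_apply (χ : I → ℝ) (g : V.posLower) :
    V.character χ g = ∏ i, (V.diagEntry i g ^ 2) ^ χ i := rfl

theorem character_eq_prod_rpow (χ : I → ℝ) (g : V.posLower) :
    V.character χ g = ∏ i, V.diagEntry i g ^ (2 * χ i) :=
  Finset.prod_congr rfl fun i _ => by rw [Real.rpow_mul (g.2 i).le, Real.rpow_two]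

theorem character_pos (χ : I → ℝ) (g : V.posLower) : 0 < V.character χ g :=
  Finset.prod_pos fun i _ => Real.rpow_pos_of_pos (pow_pos (g.2 i) 2) _

theorem character_add (χ ψ : I → ℝ) (g : V.posLower) :
    V.character (χ + ψ) g = V.character χ g * V.character ψ g := by
  simp only [character_apply, ← Finset.prod_mul_distrib]
  exact Finset.prod_congr rfl fun i _ => Real.rpow_add (pow_pos (g.2 i) 2) _ _

open Classical in
theorem genPower_hermSq (χ : I → ℝ) (g : V.posLower) :
    V.genPower χ (V.hermSq g) = V.character χ g := by
  refine Finset.prod_congr rfl fun k _ => ?_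
  congr 1
  simp only [largeMinor, strictMinor, V.factor_hermSq g.2, scal_lowerExt]
  have : Finset.univ.filter (· ≤ k) = insert k (Finset.univ.filter (· < k)) := by
    ext j
    simp [le_iff_eq_or_lt]
  rw [this, Finset.prod_insert (by simp), mul_div_cancel_right₀]
  exact Finset.prod_ne_zero_iff.2 fun j _ => pow_ne_zero _ (g.2 j).ne'

theorem genPower_dualInv_dualSq (χ : I → ℝ) (g : V.posLower) :
    V.genPower χ (V.dualInv (V.dualSq (g : LowerEntries A))) = V.character χ g⁻¹ := by
  rw [dualInv_dualSq, genPower_hermSq]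

/-- The weights `(1 + n_{i·}) / 2`: the determinant of left multiplication by `g` is
`character rowWeight g`. -/
noncomputable def rowWeight (i : I) : ℝ := (1 + V.nRow i) / 2

/-- The weights `(1 + n_{·i}) / 2`: the Jacobian of `g ↦ g g^*` is
`2 ^ |I| * character colWeight g`. -/
noncomputable def colWeight (i : I) : ℝ := (1 + V.nCol i) / 2

omit [∀ i j, FiniteDimensional ℝ (A i j)] in
theorem rowWeight_add_colWeight : V.rowWeight + V.colWeight = V.nVal := by
  ext i
  simp only [Pi.add_apply, rowWeight, colWeight, nVal]
  ring

theorem character_half (n : I → ℕ) (g : V.posLower) :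
    V.character (fun i => (n i : ℝ) / 2) g = ∏ i, V.diagEntry i g ^ n i := by
  simp only [character_eq_prod_rpow, mul_div_cancel₀ _ (two_ne_zero' ℝ), Real.rpow_natCast]

theorem det_lowerMul_eq_character (g : V.posLower) :
    LinearMap.det (V.lowerMul g) = V.character V.rowWeight g := by
  rw [det_lowerMul, ← character_half]
  simp only [Nat.cast_add, Nat.cast_one]
  rfl

theorem det_sqBilin_add_flip_eq_character (g : V.posLower) :
    LinearMap.det (V.sqBilin g + V.sqBilin.flip g) =
      2 ^ Fintype.card I * V.character V.colWeight g := by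
  rw [det_sqBilin_add_flip, Finset.prod_mul_distrib, Finset.prod_const, Finset.card_univ,
    ← character_half]
  simp only [Nat.cast_add, Nat.cast_one]
  rfl

/-! ### The closed cone and the dual cone -/

section SqNorm

omit [∀ i j, FiniteDimensional ℝ (A i j)]

theorem tr_hermSq (x : LowerEntries A) : V.tr (V.hermSq x) = V.sqNorm x := rfl

theorem tr_dualSq (x : LowerEntries A) : V.tr (V.dualSq x) = V.sqNorm x := V.tr_comm _ _

open Classical in
theorem norm_sq_le_sqNorm (x : LowerEntries A) : ‖x‖ ^ 2 ≤ V.sqNorm x := by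
  have hsum : 0 ≤ ∑ p, ‖x p‖ ^ 2 := Finset.sum_nonneg fun _ _ => sq_nonneg _
  rw [sqNorm_eq, ← Real.le_sqrt (norm_nonneg _) hsum,
    pi_norm_le_iff_of_nonneg (Real.sqrt_nonneg _)]
  exact fun p => Real.le_sqrt_of_sq_le <|
    Finset.single_le_sum (f := fun p => ‖x p‖ ^ 2) (fun _ _ => sq_nonneg _) (Finset.mem_univ p)

theorem sqNorm_pos {x : LowerEntries A} (hx : x ≠ 0) : 0 < V.sqNorm x :=
  V.tr_pos _ fun h => hx (lowerExt_injective (by rw [h, map_zero]))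

end SqNorm

theorem continuous_diagEntry (i : I) : Continuous (V.diagEntry i) :=
  LinearMap.continuous_of_finiteDimensional _

open Classical in
theorem continuous_lowerMul :
    Continuous fun p : LowerEntries A × LowerEntries A => V.lowerMul p.1 p.2 :=
  V.lowerMul.toContinuousBilinearMap.continuous₂

theorem continuous_coordsEquiv_symm : Continuous V.coordsEquiv.symm :=
  LinearMap.continuous_of_finiteDimensional V.coordsEquiv.symm.toLinearMap

open Classical in
theorem continuous_hermSq : Continuous V.hermSq := by
  have h : V.hermSq = fun x => V.coordsEquiv.symm (V.sqBilin x x) :=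
    funext fun x => V.coordsEquiv.eq_symm_apply.2 (V.coordsEquiv_hermSq x)
  rw [h]
  exact V.continuous_coordsEquiv_symm.comp (continuous_bilin_self V.sqBilin)

open Classical in
theorem continuous_dualSq : Continuous V.dualSq := by
  have h : V.dualSq = fun x => V.coordsEquiv.symm (V.dualBilin x x) :=
    funext fun x => V.coordsEquiv.eq_symm_apply.2 (V.coordsEquiv_dualSq x)
  rw [h]
  exact V.continuous_coordsEquiv_symm.comp (continuous_bilin_self V.dualBilin)

open Filter Topology

theorem isClosedMap_of_tr_eq_sqNorm {f : LowerEntries A → V.herm} (hf : Continuous f)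
    (htr : ∀ x, V.tr (f x) = V.sqNorm x) : IsClosedMap f := by
  classical
  refine (isProperMap_iff_tendsto_cocompact.2 ⟨hf, ?_⟩).isClosedMap
  have hcont : Continuous fun Z : V.herm => V.tr Z :=
    (LinearMap.continuous_of_finiteDimensional V.trLin).comp continuous_subtype_val
  have htop : Tendsto (fun x => V.tr (f x)) (cocompact (LowerEntries A)) atTop :=
    tendsto_atTop_mono (fun x => (V.norm_sq_le_sqNorm x).trans_eq (htr x).symm)
      ((tendsto_pow_atTop two_ne_zero).comp (tendsto_norm_cocompact_atTop (E := LowerEntries A)))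
  rw [hasBasis_cocompact.tendsto_right_iff]
  intro K hK
  obtain ⟨M, hM⟩ := (hK.image hcont).bddAbove
  filter_upwards [htop.eventually_gt_atTop M] with x hx hxK
  exact (hM (Set.mem_image_of_mem _ hxK)).not_gt hx

theorem isOpen_posLower : IsOpen V.posLower := by
  simp only [posLower, Set.ofPred_forall]
  exact isOpen_iInter_of_finite fun i => isOpen_lt continuous_const (V.continuous_diagEntry i)

theorem closure_posLower : closure V.posLower = {x | ∀ i, 0 ≤ V.diagEntry i x} := by
  refine (closure_minimal (fun x hx i => (hx i).le) ?_).antisymm fun x hx => ?_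
  · simp only [Set.ofPred_forall]
    exact isClosed_iInter fun i => isClosed_le continuous_const (V.continuous_diagEntry i)
  · have hlim : Tendsto (fun ε : ℝ => x + ε • V.lowerOne) (𝓝[>] 0) (𝓝 x) := by
      have : Continuous fun ε : ℝ => x + ε • V.lowerOne := by fun_prop
      exact (this.tendsto' 0 x (by simp)).mono_left nhdsWithin_le_nhds
    refine mem_closure_of_tendsto hlim ?_
    filter_upwards [self_mem_nhdsWithin] with ε hε i
    rw [map_add, map_smul, diagEntry_lowerOne, smul_eq_mul, _root_.mul_one]
    exact add_pos_of_nonneg_of_pos (hx i) hε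

theorem closure_cone : closure V.cone = V.hermSq '' closure V.posLower := by
  rw [cone_eq_image, (V.isClosedMap_of_tr_eq_sqNorm V.continuous_hermSq
    V.tr_hermSq).closure_image_eq_of_continuous V.continuous_hermSq]

/-- The pairing `(ξ, Z) ↦ tr (ξ Z)` of Hermitian matrices. -/
noncomputable def trPairing : V.herm →ₗ[ℝ] V.herm →ₗ[ℝ] ℝ :=
  (V.mulBilin.compl₁₂ V.herm.subtype V.herm.subtype).compr₂ V.trLin

section TrPairing

omit [∀ i j, FiniteDimensional ℝ (A i j)]

theorem trPairing_apply (ξ Z : V.herm) : V.trPairing ξ Z = V.tr (V.mul ξ Z) := rfl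

theorem trPairing_dualSq_hermSq (x y : LowerEntries A) :
    V.trPairing (V.dualSq x) (V.hermSq y) = V.sqNorm (V.lowerMul x y) :=
  V.tr_dualSq_mul_hermSq x y

theorem trPairing_hermSq_smul (θ : V.herm) (c : ℝ) (x : LowerEntries A) :
    V.trPairing θ (V.hermSq (c • x)) = c ^ 2 * V.trPairing θ (V.hermSq x) := by
  have : V.hermSq (c • x) = c ^ 2 • V.hermSq x := V.coordsEquiv.injective <| by
    rw [map_smul, coordsEquiv_hermSq, coordsEquiv_hermSq,
      LinearMap.map_smul₂, map_smul, smul_smul, sq]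
  rw [this, map_smul, smul_eq_mul]

theorem trPairing_injective : Function.Injective V.trPairing := by
  refine (injective_iff_map_eq_zero _).2 fun ξ hξ => ?_
  by_contra hne
  have hpos := V.tr_pos ξ (Subtype.coe_injective.ne hne)
  rw [V.mem_herm.1 ξ.2, ← trPairing_apply, hξ, LinearMap.zero_apply] at hpos
  exact lt_irrefl _ hpos

end TrPairing

theorem trPairing_surjective : Function.Surjective V.trPairing :=
  (LinearMap.injective_iff_surjective_of_finrank_eq_finrank
    (Subspace.dual_finrank_eq (K := ℝ) (V := V.herm)).symm).1 V.trPairing_injective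

theorem mem_dualCone_iff {θ : V.herm} : θ ∈ V.dualCone ↔
    ∀ x ∈ closure V.posLower, x ≠ 0 → 0 < V.trPairing θ (V.hermSq x) := by
  have hermSq_eq_zero : ∀ x, V.hermSq x = 0 ↔ x = 0 := by
    intro x
    constructor
    · intro h
      by_contra hx
      have hpos := V.sqNorm_pos hx
      rw [← tr_hermSq, h] at hpos
      exact hpos.ne' (map_zero V.trLin)
    · rintro rfl
      exact V.coordsEquiv.injective (by rw [coordsEquiv_hermSq, map_zero, map_zero])
  simp only [dualCone, closure_cone, Set.mem_ofPred_eq, Set.forall_mem_image, ne_eq,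
    hermSq_eq_zero, trPairing_apply]

theorem continuous_trPairing : Continuous fun p : V.herm × V.herm => V.trPairing p.1 p.2 :=
  V.trPairing.toContinuousBilinearMap.continuous₂

theorem continuous_trPairing_hermSq :
    Continuous fun p : V.herm × LowerEntries A => V.trPairing p.1 (V.hermSq p.2) := by
  have h : Continuous fun p : V.herm × LowerEntries A => (p.1, V.hermSq p.2) :=
    continuous_fst.prodMk (V.continuous_hermSq.comp continuous_snd)
  exact (Continuous.comp V.continuous_trPairing h :)

theorem isOpen_dualCone : IsOpen V.dualCone := by
  classical
  let K : Set (LowerEntries A) := closure V.posLower ∩ Metric.sphere 0 1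
  have hK : IsCompact K := (isCompact_sphere _ _).inter_left isClosed_closure
  have hdual : V.dualCone = {θ | ∀ x ∈ K, 0 < V.trPairing θ (V.hermSq x)} := by
    ext θ
    refine V.mem_dualCone_iff.trans ⟨fun h x hx => h x hx.1
      (norm_ne_zero_iff.1 (by rw [mem_sphere_zero_iff_norm.1 hx.2]; exact one_ne_zero)),
      fun h x hx hx0 => ?_⟩
    have hnorm : 0 < ‖x‖⁻¹ := inv_pos.2 (norm_pos_iff.2 hx0)
    have hmem : ‖x‖⁻¹ • x ∈ K := by
      refine ⟨?_, by simp [norm_smul, hx0]⟩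
      rw [closure_posLower] at hx ⊢
      exact fun i => by simpa using mul_nonneg hnorm.le (hx i)
    have hpos := h _ hmem
    rw [trPairing_hermSq_smul] at hpos
    exact pos_of_mul_pos_right hpos (sq_nonneg _)
  rw [hdual, isOpen_iff_eventually]
  exact fun θ hθ => hK.eventually_forall_of_forall_eventually fun x hx =>
    V.continuous_trPairing_hermSq.continuousAt.eventually (lt_mem_nhds (hθ x hx))

theorem convex_dualCone : Convex ℝ V.dualCone := by
  have : V.dualCone = ⋂ x ∈ closure V.posLower \ {0},
      {θ | 0 < V.trPairing.flip (V.hermSq x) θ} := by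
    ext θ
    simp [mem_dualCone_iff]
  rw [this]
  exact convex_iInter₂ fun x _ => convex_halfSpace_gt (LinearMap.isLinear _) 0

theorem dualSq_mem_dualCone (g : V.posLower) : V.dualSq g ∈ V.dualCone := by
  refine V.mem_dualCone_iff.2 fun x _ hx => ?_
  rw [trPairing_dualSq_hermSq]
  exact V.sqNorm_pos ((map_ne_zero_iff _
    (LinearMap.equivOfDetNeZero _ (V.det_lowerMul_pos g.2).ne').injective).2 hx)

theorem exists_mem_closure_posLower_lowerMul_eq_zero {q : LowerEntries A} {j : I}
    (hq : V.diagEntry j q = 0) : ∃ x ∈ closure V.posLower, x ≠ 0 ∧ V.lowerMul q x = 0 := by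
  have hdet : LinearMap.det (V.lowerMul q) = 0 := by
    rw [det_lowerMul]
    exact Finset.prod_eq_zero (Finset.mem_univ j) (by rw [hq, zero_pow (by omega)])
  obtain ⟨w, hw, hw0⟩ := (LinearMap.ker (V.lowerMul q)).ne_bot_iff.1
    (LinearMap.bot_lt_ker_of_det_eq_zero hdet).ne'
  -- changing the signs of the columns of `w` makes its diagonal nonnegative
  let s : I → ℝ := fun i => if 0 ≤ V.diagEntry i w then 1 else -1
  have hs : ∀ i, s i ≠ 0 := fun i => by
    dsimp only [s]
    split_ifs <;> norm_num
  have hext : ∀ i j, lowerExt (fun p => s p.1.2 • w p) i j = s j • lowerExt w i j := by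
    intro i j
    by_cases h : j ≤ i
    · simp only [lowerExt_of_le _ h]
    · simp only [lowerExt_of_not_le _ h, smul_zero]
  refine ⟨fun p => s p.1.2 • w p, ?_, fun h => hw0 ?_, ?_⟩
  · rw [closure_posLower]
    intro i
    rw [← scal_lowerExt, hext, map_smul, scal_lowerExt, smul_eq_mul]
    dsimp only [s]
    split_ifs with h
    · rwa [_root_.one_mul]
    · linarith
  · exact funext fun p => (smul_eq_zero.1 (congrFun h p)).resolve_left (hs _)
  · ext p
    have hp : V.lowerMul q w p = 0 := congrFun hw p
    simp only [lowerMul_apply, lowerRes_apply, VinbergData.mul, hext, map_smul,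
      ← Finset.smul_sum] at hp ⊢
    rw [hp, smul_zero, Pi.zero_apply]

open Classical in
theorem isOpen_image_dualSq : IsOpen (V.dualSq '' V.posLower) := by
  have himage : V.dualSq '' V.posLower =
      V.coordsEquiv ⁻¹' ((fun x => V.dualBilin x x) '' V.posLower) := by
    ext Z
    simp [← coordsEquiv_dualSq]
  rw [himage]
  refine IsOpen.preimage (LinearMap.continuous_of_finiteDimensional V.coordsEquiv.toLinearMap)
    (isOpen_image_bilin_self V.isOpen_posLower fun x hx => ?_)
  exact (LinearMap.equivOfDetNeZero _
    (V.det_dualBilin_add_flip_ne_zero fun i => (hx i).ne')).surjective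

/- The image of `dualSq` is open and relatively closed in the connected set `𝒫^*`: a limit `q` of
factors that has a zero on its diagonal kills a nonzero `x`, and then `tr (q^* q x x^*) = 0`. -/
theorem dualCone_eq_image : V.dualCone = V.dualSq '' V.posLower := by
  refine Set.Subset.antisymm ?_ (Set.image_subset_iff.2 fun x hx => V.dualSq_mem_dualCone ⟨x, hx⟩)
  refine V.convex_dualCone.isPreconnected.subset_of_closure_inter_subset V.isOpen_image_dualSq
    ⟨_, V.dualSq_mem_dualCone 1, Set.mem_image_of_mem _ (1 : V.posLower).2⟩ ?_
  rw [(V.isClosedMap_of_tr_eq_sqNorm V.continuous_dualSq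
    V.tr_dualSq).closure_image_eq_of_continuous V.continuous_dualSq]
  rintro _ ⟨⟨q, hq, rfl⟩, hdual⟩
  refine Set.mem_image_of_mem _ fun j => ?_
  rw [closure_posLower] at hq
  refine (hq j).lt_of_ne' fun hj => ?_
  obtain ⟨x, hx, hx0, hqx⟩ := V.exists_mem_closure_posLower_lowerMul_eq_zero hj
  have hpos := V.mem_dualCone_iff.1 hdual x hx hx0
  rw [trPairing_dualSq_hermSq, hqx, sqNorm_eq] at hpos
  simp at hpos

variable [∀ i j, MeasurableSpace (A i j)] [∀ i j, BorelSpace (A i j)]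

/-! ### Relatively invariant measures on the group -/

instance : ContinuousMul V.posLower :=
  ⟨((Continuous.comp V.continuous_lowerMul ((continuous_subtype_val.comp continuous_fst).prodMk
    (continuous_subtype_val.comp continuous_snd)) :)).subtype_mk _⟩

instance : ContinuousInv V.posLower := by
  classical
  let L : LowerEntries A →L[ℝ] LowerEntries A →L[ℝ] LowerEntries A :=
    V.lowerMul.toContinuousBilinearMap
  have hL (g h : V.posLower) : L g * L h = L ↑(g * h) := by
    ext x : 1
    exact (V.lowerMul_assoc g h x).symm
  have hL_one : L ↑(1 : V.posLower) = 1 := by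
    ext x : 1
    exact V.lowerOne_lowerMul x
  let u (g : V.posLower) : (LowerEntries A →L[ℝ] LowerEntries A)ˣ :=
    ⟨L g, L ↑g⁻¹, by rw [hL, mul_inv_cancel, hL_one], by rw [hL, inv_mul_cancel, hL_one]⟩
  have hinv (g : V.posLower) : ((g⁻¹ : V.posLower) : LowerEntries A) =
      Ring.inverse (L g) V.lowerOne := by
    rw [show L g = u g from rfl, Ring.inverse_unit]
    exact (V.lowerMul_lowerOne _).symm
  refine ⟨continuous_induced_rng.2 ?_⟩
  simp only [Function.comp_def, hinv]
  refine Continuous.clm_apply (continuous_iff_continuousAt.2 fun g => ?_) continuous_const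
  have hu : ContinuousAt Ring.inverse (L g) :=
    NormedRing.inverse_continuousAt (R := LowerEntries A →L[ℝ] LowerEntries A) (u g)
  exact hu.comp (f := fun g : V.posLower => L g)
    (L.continuous.comp continuous_subtype_val).continuousAt

theorem measurableSet_posLower : MeasurableSet V.posLower := V.isOpen_posLower.measurableSet

theorem measurable_character (χ : I → ℝ) : Measurable (V.character χ) :=
  Finset.measurable_prod _ fun i _ =>
    (((V.continuous_diagEntry i).measurable.comp measurable_subtype_coe).pow_const 2).pow_const _

open Classical in
/-- Lebesgue measure on `𝒯_l^+`. -/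
noncomputable def lowerVolume : Measure V.posLower := Measure.comap Subtype.val volume

theorem isRelLeftInvariant_lowerVolume :
    IsRelLeftInvariant (V.character V.rowWeight) V.lowerVolume := by
  classical
  intro g
  have hval := MeasurableEmbedding.subtype_coe V.measurableSet_posLower
  ext s hs
  have himage : ((↑) : V.posLower → LowerEntries A) '' s =
      V.lowerMul g '' ((↑) '' ((g * ·) ⁻¹' s)) := by
    conv_lhs => rw [← Set.image_preimage_eq s (Group.mulLeft_bijective g).surjective]
    simp only [Set.image_image, coe_mul]
  rw [Measure.smul_apply, smul_eq_mul, Measure.map_apply (measurable_const_mul g) hs,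
    lowerVolume, hval.comap_apply, hval.comap_apply, himage, Measure.addHaar_image_linearMap,
    det_lowerMul_eq_character, abs_of_pos (V.character_pos _ g)]

/-- The measure `χ(g) ν(dg)` on `𝒯_l^+`, where `ν` is the left Haar measure
`character rowWeight g⁻¹ dg`. -/
noncomputable def relHaar (χ : I → ℝ) : Measure V.posLower :=
  V.lowerVolume.withDensity fun g => ENNReal.ofReal (V.character (χ - V.rowWeight) g)

theorem relHaar_add (χ ψ : I → ℝ) : V.relHaar (χ + ψ) =
    (V.relHaar χ).withDensity fun g => ENNReal.ofReal (V.character ψ g) := by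
  rw [relHaar, relHaar, ← withDensity_mul _ (V.measurable_character _).ennreal_ofReal
    (V.measurable_character _).ennreal_ofReal, add_sub_right_comm]
  congr 1
  ext g
  rw [character_add, ENNReal.ofReal_mul (V.character_pos _ g).le, Pi.mul_apply]

theorem isRelLeftInvariant_relHaar (χ : I → ℝ) :
    IsRelLeftInvariant (V.character χ) (V.relHaar χ) := by
  have hmul : V.character χ = V.character V.rowWeight * V.character (χ - V.rowWeight) :=
    MonoidHom.ext fun g => by rw [MonoidHom.mul_apply, ← character_add, add_sub_cancel]
  rw [hmul]
  exact V.isRelLeftInvariant_lowerVolume.withDensity (V.measurable_character _) (V.character_pos _)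

instance (χ : I → ℝ) : SigmaFinite (V.relHaar χ) := by
  classical
  have : LocallyCompactSpace V.posLower := V.isOpen_posLower.locallyCompactSpace
  have : IsFiniteMeasureOnCompacts V.lowerVolume :=
    .comap' _ continuous_subtype_val (MeasurableEmbedding.subtype_coe V.measurableSet_posLower)
  exact SigmaFinite.withDensity_of_ne_top (.of_forall fun _ => ENNReal.ofReal_ne_top)

theorem lowerVolume_ne_zero : V.lowerVolume ≠ 0 := by
  classical
  rw [← Measure.measure_univ_ne_zero, lowerVolume,
    (MeasurableEmbedding.subtype_coe V.measurableSet_posLower).comap_apply, Set.image_univ,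
    Subtype.range_coe]
  exact (V.isOpen_posLower.measure_pos volume ⟨_, V.lowerOne_mem_posLower⟩).ne'

theorem relHaar_ne_zero (χ : I → ℝ) : V.relHaar χ ≠ 0 := fun h => V.lowerVolume_ne_zero <| by
  rw [← Measure.absolutelyContinuous_zero_iff, ← h]
  exact withDensity_absolutelyContinuous' (V.measurable_character _).ennreal_ofReal.aemeasurable
    (.of_forall fun g => (ENNReal.ofReal_pos.2 (V.character_pos _ g)).ne')

/-! ### Riesz measures as measures on the group -/

omit [∀ i j, BorelSpace (A i j)] in
theorem isRiesz_iff {χ : I → ℝ} {ρ : Measure V.herm} : V.IsRiesz χ ρ ↔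
    ρ (closure V.cone)ᶜ = 0 ∧ ∀ g : V.posLower,
      ∫⁻ Z, ENNReal.ofReal (Real.exp (-V.trPairing (V.dualSq g) Z)) ∂ρ =
        ENNReal.ofReal (V.character χ g⁻¹) := by
  refine and_congr_right fun _ => ?_
  rw [dualCone_eq_image, Set.forall_mem_image, SetCoe.forall']
  simp only [genPower_dualInv_dualSq]
  rfl

theorem IsRiesz.unique {V : VinbergAlgebra A} {χ : I → ℝ} {R R' : Measure V.herm}
    (h : V.IsRiesz χ R) (h' : V.IsRiesz χ R') : R = R' := by
  let Φ : V.herm →ₗ[ℝ] StrongDual ℝ V.herm :=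
    LinearMap.toContinuousLinearMap.toLinearMap ∘ₗ V.trPairing
  have hΦ : Function.Surjective Φ :=
    LinearMap.toContinuousLinearMap.surjective.comp V.trPairing_surjective
  refine ext_of_laplace_of_isOpen
    (Φ.isOpenMap_of_finiteDimensional hΦ _ V.isOpen_dualCone)
    (Set.Nonempty.image _ ⟨_, V.dualSq_mem_dualCone 1⟩) ?_ ?_ <;>
    rintro _ ⟨θ, hθ, rfl⟩
  · exact (h.2 θ hθ).trans_ne ENNReal.ofReal_ne_top
  · exact (h.2 θ hθ).trans (h'.2 θ hθ).symm

/-- The orbit map `g ↦ g g^*` of the group `𝒯_l^+` at `e`, a bijection onto `𝒫`. -/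
noncomputable def orbitMap (g : V.posLower) : V.herm := V.hermSq g

omit [∀ i j, FiniteDimensional ℝ (A i j)] [∀ i j, MeasurableSpace (A i j)]
  [∀ i j, BorelSpace (A i j)] in
theorem range_orbitMap : Set.range V.orbitMap = V.cone := by
  rw [cone_eq_image, Set.image_eq_range]
  rfl

theorem measurableEmbedding_orbitMap : MeasurableEmbedding V.orbitMap :=
  have : StandardBorelSpace V.posLower := V.measurableSet_posLower.standardBorel
  (V.continuous_hermSq.comp continuous_subtype_val).measurable.measurableEmbedding fun _ _ h =>
    Subtype.ext (V.hermSq_injOn (Subtype.coe_prop _) (Subtype.coe_prop _) h)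

theorem measurableSet_cone : MeasurableSet V.cone := by
  rw [← range_orbitMap]
  exact V.measurableEmbedding_orbitMap.measurableSet_range

theorem lintegral_map_orbitMap (m : Measure V.posLower) (g : V.posLower) :
    ∫⁻ Z, ENNReal.ofReal (Real.exp (-V.trPairing (V.dualSq g) Z)) ∂m.map V.orbitMap =
      ∫⁻ h, ENNReal.ofReal (Real.exp (-V.sqNorm ↑(g * h))) ∂m := by
  rw [V.measurableEmbedding_orbitMap.lintegral_map]
  simp only [orbitMap, trPairing_dualSq_hermSq, coe_mul]

theorem isRiesz_map_orbitMap_iff {χ : I → ℝ} {m : Measure V.posLower} :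
    V.IsRiesz χ (m.map V.orbitMap) ↔ ∀ g : V.posLower,
      ∫⁻ h, ENNReal.ofReal (Real.exp (-V.sqNorm ↑(g * h))) ∂m =
        ENNReal.ofReal (V.character χ g⁻¹) := by
  have hsupp : m.map V.orbitMap (closure V.cone)ᶜ = 0 := by
    refine measure_mono_null (Set.compl_subset_compl.2 subset_closure) ?_
    rw [V.measurableEmbedding_orbitMap.map_apply, ← range_orbitMap, Set.preimage_compl,
      Set.preimage_range, Set.compl_univ, measure_empty]
  simp only [isRiesz_iff, hsupp, true_and, lintegral_map_orbitMap]

/-- The substitution `θ = g^* g` turns the Laplace transform into translation by `g`, so that by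
uniqueness the Riesz property becomes relative invariance. -/
theorem isRiesz_map_orbitMap_iff_isRelLeftInvariant {χ : I → ℝ} {m : Measure V.posLower} :
    V.IsRiesz χ (m.map V.orbitMap) ↔ IsRelLeftInvariant (V.character χ) m ∧
      ∫⁻ g, ENNReal.ofReal (Real.exp (-V.sqNorm (g : LowerEntries A))) ∂m = 1 := by
  constructor
  · intro hR
    have hlap := V.isRiesz_map_orbitMap_iff.1 hR
    refine ⟨fun g => V.measurableEmbedding_orbitMap.map_injective (hR.unique ?_), ?_⟩
    · refine V.isRiesz_map_orbitMap_iff.2 fun h => ?_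
      rw [lintegral_smul_measure, smul_eq_mul, (measurableEmbedding_mulLeft g).lintegral_map]
      simp only [← mul_assoc, hlap]
      rw [← ENNReal.ofReal_mul (V.character_pos _ _).le, ← map_mul, mul_inv_rev,
        mul_inv_cancel_left]
    · simpa only [_root_.one_mul, inv_one, map_one, ENNReal.ofReal_one] using hlap 1
  · rintro ⟨hm, hone⟩
    refine V.isRiesz_map_orbitMap_iff.2 fun g => ?_
    rw [hm.lintegral_mul_left fun h => ENNReal.ofReal (Real.exp (-V.sqNorm (h : LowerEntries A))),
      hone, _root_.mul_one]

/-! ### Lebesgue measure in the coordinates `g ↦ g g^*` -/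

theorem measurableEmbedding_lowerCoords : MeasurableEmbedding V.lowerCoords :=
  (LinearMap.continuous_of_finiteDimensional V.coordsEquiv.toLinearMap).measurableEmbedding
    V.coordsEquiv.injective

open Classical in
theorem measurePreserving_lowerCoords : MeasurePreserving V.lowerCoords V.lebesgue volume := by
  have hrange : Set.range V.lowerCoords = Set.univ := V.coordsEquiv.surjective.range_eq
  refine ⟨V.measurableEmbedding_lowerCoords.measurable, ?_⟩
  rw [lebesgue, V.measurableEmbedding_lowerCoords.map_comap, hrange, Measure.restrict_univ]

theorem relHaar_nVal : V.relHaar V.nVal =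
    V.lowerVolume.withDensity fun g => ENNReal.ofReal (V.character V.colWeight g) := by
  rw [relHaar, ← rowWeight_add_colWeight, add_sub_cancel_left]

open Classical in
theorem volume_restrict_lowerCoords_image_cone : volume.restrict (V.lowerCoords '' V.cone) =
    ENNReal.ofReal (2 ^ Fintype.card I) • (V.relHaar V.nVal).map (V.lowerCoords ∘ V.orbitMap) := by
  have hval := MeasurableEmbedding.subtype_coe V.measurableSet_posLower
  let sq : LowerEntries A → LowerEntries A := fun x => V.sqBilin x x
  let jac : LowerEntries A → ENNReal := fun x =>
    ENNReal.ofReal |(LinearMap.toContinuousLinearMap (V.sqBilin x + V.sqBilin.flip x)).det|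
  have hsq : Measurable sq := (continuous_bilin_self V.sqBilin).measurable
  have himage : V.lowerCoords '' V.cone = sq '' V.posLower := by
    rw [cone_eq_image, Set.image_image]
    rfl
  have change_of_variables : Measure.map sq ((volume.restrict V.posLower).withDensity jac) =
      volume.restrict (sq '' V.posLower) :=
    map_withDensity_abs_det_fderiv_eq_addHaar volume V.measurableSet_posLower.nullMeasurableSet
      (fun x _ => (hasStrictFDerivAt_bilin_self V.sqBilin x).hasFDerivAt.hasFDerivWithinAt)
      fun x hx y hy h => V.hermSq_injOn hx hy (V.coordsEquiv.injective h)
  have hjac : jac ∘ Subtype.val = ENNReal.ofReal (2 ^ Fintype.card I) •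
      fun g => ENNReal.ofReal (V.character V.colWeight g) := by
    ext g
    have hpos := V.character_pos V.colWeight g
    simp only [jac, Function.comp_apply, LinearMap.det_toContinuousLinearMap,
      det_sqBilin_add_flip_eq_character]
    rw [abs_of_pos (by positivity), ENNReal.ofReal_mul (by positivity), Pi.smul_apply, smul_eq_mul]
  calc volume.restrict (V.lowerCoords '' V.cone)
      = ((V.lowerVolume.withDensity (jac ∘ Subtype.val)).map Subtype.val).map sq := by
        rw [himage, ← change_of_variables, ← map_comap_subtype_coe V.measurableSet_posLower,
          withDensity_map hval]
        rfl
    _ = _ := by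
        rw [hjac, withDensity_smul _ (V.measurable_character _).ennreal_ofReal, ← relHaar_nVal,
          Measure.map_map hsq hval.measurable, Measure.map_smul]
        rfl

theorem lebesgue_restrict_cone : V.lebesgue.restrict V.cone =
    ENNReal.ofReal (2 ^ Fintype.card I) • (V.relHaar V.nVal).map V.orbitMap := by
  classical
  have hcoords := V.measurableEmbedding_lowerCoords
  refine hcoords.map_injective ?_
  rw [Measure.map_smul, Measure.map_map hcoords.measurable
    V.measurableEmbedding_orbitMap.measurable, ← volume_restrict_lowerCoords_image_cone,
    ← V.measurePreserving_lowerCoords.map_eq, hcoords.restrict_map,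
    hcoords.injective.preimage_image]

theorem lebesgue_closure_diff_cone : V.lebesgue (closure V.cone \ V.cone) = 0 := by
  classical
  have hnull : volume (closure V.posLower \ V.posLower) = 0 := by
    have hker : closure V.posLower \ V.posLower ⊆
        ⋃ i, (LinearMap.ker (V.diagEntry i) : Set (LowerEntries A)) := by
      intro x ⟨hx, hx'⟩
      rw [closure_posLower] at hx
      simp only [posLower, Set.mem_ofPred_eq, not_forall, not_lt] at hx'
      obtain ⟨i, hi⟩ := hx'
      exact Set.mem_iUnion.2 ⟨i, hi.antisymm (hx i)⟩
    refine measure_mono_null hker <| measure_iUnion_null fun i => Measure.addHaar_submodule _ _ ?_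
    intro htop
    have : V.lowerOne ∈ LinearMap.ker (V.diagEntry i) := htop ▸ Submodule.mem_top
    rw [LinearMap.mem_ker, diagEntry_lowerOne] at this
    exact one_ne_zero this
  rw [lebesgue, V.measurableEmbedding_lowerCoords.comap_apply]
  refine measure_mono_null ?_ (addHaar_image_eq_zero_of_differentiableOn_of_addHaar_eq_zero volume
    (f := fun x => V.sqBilin x x) (fun x _ =>
      (hasStrictFDerivAt_bilin_self V.sqBilin x).differentiableAt.differentiableWithinAt) hnull)
  rw [closure_cone, cone_eq_image]
  rintro _ ⟨_, ⟨⟨x, hx, rfl⟩, hx'⟩, rfl⟩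
  exact ⟨x, ⟨hx, fun h => hx' ⟨x, h, rfl⟩⟩, rfl⟩

theorem withDensity_genPower_eq_map_relHaar {χ : I → ℝ} {c : ℝ} (hc : 0 ≤ c) :
    V.lebesgue.withDensity (V.cone.indicator fun Z =>
        ENNReal.ofReal (c * V.genPower (fun i => χ i + -V.nVal i) Z)) =
      (ENNReal.ofReal (c * 2 ^ Fintype.card I) • V.relHaar χ).map V.orbitMap := by
  have hdensity : (fun Z : V.herm => ENNReal.ofReal
      (c * V.genPower (fun i => χ i + -V.nVal i) Z)) ∘ V.orbitMap =
      ENNReal.ofReal c • fun g => ENNReal.ofReal (V.character (χ - V.nVal) g) := by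
    ext g
    simp only [Function.comp_apply, orbitMap, genPower_hermSq, ENNReal.ofReal_mul hc]
    rfl
  rw [withDensity_indicator V.measurableSet_cone, lebesgue_restrict_cone,
    withDensity_smul_measure, withDensity_map V.measurableEmbedding_orbitMap, hdensity,
    withDensity_smul _ (V.measurable_character _).ennreal_ofReal, ← relHaar_add,
    add_sub_cancel, Measure.map_smul, Measure.map_smul, smul_smul, mul_comm c,
    ENNReal.ofReal_mul (by positivity)]

/-! ### The Gamma integral -/

section DiagFactor

omit [∀ i j, FiniteDimensional ℝ (A i j)] [∀ i j, MeasurableSpace (A i j)]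
  [∀ i j, BorelSpace (A i j)]

open Classical in
/-- The function `f i` of the diagonal entries `(i, i)`, extended by `1` to the other entries. -/
noncomputable def diagFactor (f : I → ℝ → ENNReal) (i : I) : ∀ j, A i j → ENNReal :=
  Function.update (fun _ _ => 1) i fun u => f i (V.scal i u)

theorem diagFactor_self (f : I → ℝ → ENNReal) (i : I) (u : A i i) :
    V.diagFactor f i i u = f i (V.scal i u) := by
  classical rw [diagFactor, Function.update_self]

theorem diagFactor_of_lt (f : I → ℝ → ENNReal) {i j : I} (h : j < i) (u : A i j) :
    V.diagFactor f i j u = 1 := by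
  classical rw [diagFactor, Function.update_of_ne h.ne]

open Classical in
theorem prod_diagFactor (f : I → ℝ → ENNReal) (x : LowerEntries A) :
    ∏ p : LowerIndex I, V.diagFactor f p.1.1 p.1.2 (x p) = ∏ i, f i (V.diagEntry i x) := by
  calc ∏ p : LowerIndex I, V.diagFactor f p.1.1 p.1.2 (x p)
      = ∏ p : LowerIndex I, V.diagFactor f p.1.1 p.1.2 (lowerExt x p.1.1 p.1.2) :=
        Finset.prod_congr rfl fun p _ => by rw [lowerExt_of_le x p.2]
    _ = ∏ i, f i (V.diagEntry i x) := by
        rw [prod_lowerIndex_eq_prod_row fun i j => V.diagFactor f i j (lowerExt x i j)]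
        refine Finset.prod_congr rfl fun i _ => ?_
        rw [Finset.prod_eq_one fun j hj => V.diagFactor_of_lt f (Finset.mem_filter.1 hj).2 _,
          _root_.mul_one, diagFactor_self, scal_lowerExt]

end DiagFactor

theorem measurePreserving_scal (i : I) : MeasurePreserving (V.scal i) :=
  let e : A i i ≃ₗᵢ[ℝ] ℝ := ⟨V.scal i, fun a => by rw [norm_diag, Real.norm_eq_abs]⟩
  e.measurePreserving

theorem measurable_diagFactor {f : I → ℝ → ENNReal} (hf : ∀ i, Measurable (f i))
    (p : LowerIndex I) : Measurable (V.diagFactor f p.1.1 p.1.2) := by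
  obtain ⟨⟨i, j⟩, (hij : j ≤ i)⟩ := p
  obtain rfl | hlt := hij.eq_or_lt
  · rw [funext (V.diagFactor_self f j)]
    exact (hf j).comp (V.measurePreserving_scal j).measurable
  · rw [funext (V.diagFactor_of_lt f hlt)]
    exact measurable_const

open Classical in
theorem lintegral_diagEntry_mul_exp_neg_sqNorm {f : I → ℝ → ENNReal} (hf : ∀ i, Measurable (f i)) :
    ∫⁻ x, (∏ i, f i (V.diagEntry i x)) * ENNReal.ofReal (Real.exp (-V.sqNorm x)) =
      (∏ i, ∫⁻ t, f i t * ENNReal.ofReal (Real.exp (-t ^ 2))) *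
        ENNReal.ofReal (Real.pi ^ (((∑ i, V.nRow i : ℕ) : ℝ) / 2)) := by
  let F (i j : I) (u : A i j) : ENNReal :=
    V.diagFactor f i j u * ENNReal.ofReal (Real.exp (-‖u‖ ^ 2))
  have factorization (x : LowerEntries A) : (∏ i, f i (V.diagEntry i x)) *
      ENNReal.ofReal (Real.exp (-V.sqNorm x)) = ∏ p : LowerIndex I, F p.1.1 p.1.2 (x p) := by
    rw [Finset.prod_mul_distrib, prod_diagFactor,
      ← ENNReal.ofReal_prod_of_nonneg fun _ _ => (Real.exp_pos _).le, ← Real.exp_sum,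
      Finset.sum_neg_distrib, sqNorm_eq]
  have lintegral_diag (i : I) :
      ∫⁻ u, F i i u = ∫⁻ t, f i t * ENNReal.ofReal (Real.exp (-t ^ 2)) := by
    simp only [F, diagFactor_self, V.norm_diag, sq_abs]
    exact (V.measurePreserving_scal i).lintegral_comp
      (f := fun t => f i t * ENNReal.ofReal (Real.exp (-t ^ 2))) ((hf i).mul (by fun_prop))
  have lintegral_of_lt {i j : I} (h : j < i) :
      ∫⁻ u, F i j u = ENNReal.ofReal (Real.pi ^ ((Module.finrank ℝ (A i j) : ℝ) / 2)) := by
    simp only [F, V.diagFactor_of_lt f h, _root_.one_mul, lintegral_exp_neg_norm_sq]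
  have F_measurable (p : LowerIndex I) : Measurable (F p.1.1 p.1.2) :=
    (V.measurable_diagFactor hf p).mul (by fun_prop)
  have hpi (r : ℝ) : 0 ≤ Real.pi ^ r := Real.rpow_nonneg Real.pi_pos.le r
  simp only [factorization]
  rw [volume_pi, lintegral_pi_prod_eq_prod (f := fun p : LowerIndex I => F p.1.1 p.1.2) _
      F_measurable, prod_lowerIndex_eq_prod_row fun i j => ∫⁻ u, F i j u, Finset.prod_mul_distrib]
  congr 1
  · exact Finset.prod_congr rfl fun i _ => lintegral_diag i
  · rw [Finset.prod_congr rfl fun i _ => Finset.prod_congr rfl fun j hj =>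
      lintegral_of_lt (Finset.mem_filter.1 hj).2]
    simp only [nRow, Nat.cast_sum, Finset.sum_div, Real.rpow_sum_of_pos Real.pi_pos]
    rw [ENNReal.ofReal_prod_of_nonneg fun i _ => Finset.prod_nonneg fun j _ => hpi _]
    simp only [ENNReal.ofReal_prod_of_nonneg fun _ _ => hpi _]

omit [∀ i j, FiniteDimensional ℝ (A i j)] [∀ i j, MeasurableSpace (A i j)]
  [∀ i j, BorelSpace (A i j)] in
theorem prod_indicator_diagEntry (f : I → ℝ → ENNReal) (x : LowerEntries A) :
    ∏ i, (Set.Ioi 0).indicator (f i) (V.diagEntry i x) =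
      V.posLower.indicator (fun x => ∏ i, f i (V.diagEntry i x)) x := by
  by_cases hx : x ∈ V.posLower
  · rw [Set.indicator_of_mem hx]
    exact Finset.prod_congr rfl fun i _ => Set.indicator_of_mem (hx i) _
  · obtain ⟨i, hi⟩ := not_forall.1 hx
    rw [Set.indicator_of_notMem hx]
    exact Finset.prod_eq_zero (Finset.mem_univ i) (Set.indicator_of_notMem hi _)

theorem measurable_ofReal_exp_neg_sqNorm :
    Measurable fun g : V.posLower => ENNReal.ofReal (Real.exp (-V.sqNorm (g : LowerEntries A))) :=
  (V.continuous_sqNorm.comp continuous_subtype_val).measurable.neg.exp.ennreal_ofReal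

theorem lintegral_relHaar (χ : I → ℝ) :
    ∫⁻ g, ENNReal.ofReal (Real.exp (-V.sqNorm (g : LowerEntries A))) ∂V.relHaar χ =
      (∏ i, ∫⁻ t in Set.Ioi (0 : ℝ),
        ENNReal.ofReal (t ^ (2 * (χ i - V.rowWeight i)) * Real.exp (-t ^ 2))) *
        ENNReal.ofReal (Real.pi ^ (((∑ i, V.nRow i : ℕ) : ℝ) / 2)) := by
  classical
  let f (i : I) (t : ℝ) : ENNReal := ENNReal.ofReal (t ^ (2 * (χ i - V.rowWeight i)))
  let w (x : LowerEntries A) : ENNReal := ENNReal.ofReal (Real.exp (-V.sqNorm x))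
  have hf (i : I) : Measurable ((Set.Ioi 0).indicator (f i)) :=
    (Measurable.ennreal_ofReal (by fun_prop)).indicator measurableSet_Ioi
  have character_eq (g : V.posLower) : ENNReal.ofReal (V.character (χ - V.rowWeight) g) =
      ∏ i, f i (V.diagEntry i g) := by
    rw [character_eq_prod_rpow,
      ENNReal.ofReal_prod_of_nonneg fun i _ => Real.rpow_nonneg (g.2 i).le _]
    rfl
  calc ∫⁻ g, w g ∂V.relHaar χ
      = ∫⁻ g : V.posLower, (∏ i, f i (V.diagEntry i g)) * w g ∂V.lowerVolume := by
        rw [relHaar, lintegral_withDensity_eq_lintegral_mul _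
          (V.measurable_character _).ennreal_ofReal V.measurable_ofReal_exp_neg_sqNorm]
        simp only [character_eq, Pi.mul_apply, w]
    _ = ∫⁻ x, (∏ i, (Set.Ioi 0).indicator (f i) (V.diagEntry i x)) * w x := by
        rw [lowerVolume, lintegral_subtype_comap V.measurableSet_posLower fun x =>
          (∏ i, f i (V.diagEntry i x)) * w x, ← lintegral_indicator V.measurableSet_posLower]
        simp only [prod_indicator_diagEntry, Set.indicator_mul_left]
    _ = _ := by
        rw [V.lintegral_diagEntry_mul_exp_neg_sqNorm hf]
        simp only [← lintegral_indicator measurableSet_Ioi, f,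
          ENNReal.ofReal_mul' (Real.exp_pos _).le, Set.indicator_mul_left]

theorem nRow_div_two_lt_of_lintegral_relHaar_ne_top {χ : I → ℝ}
    (h : ∫⁻ g, ENNReal.ofReal (Real.exp (-V.sqNorm (g : LowerEntries A))) ∂V.relHaar χ ≠ ⊤)
    (i : I) : (V.nRow i : ℝ) / 2 < χ i := by
  classical
  rw [lintegral_relHaar, ← Finset.mul_prod_erase _ _ (Finset.mem_univ i), mul_assoc] at h
  have hne : (∏ j ∈ Finset.univ.erase i, ∫⁻ t in Set.Ioi (0 : ℝ),
      ENNReal.ofReal (t ^ (2 * (χ j - V.rowWeight j)) * Real.exp (-t ^ 2))) *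
        ENNReal.ofReal (Real.pi ^ (((∑ i, V.nRow i : ℕ) : ℝ) / 2)) ≠ 0 :=
    mul_ne_zero (Finset.prod_ne_zero_iff.2 fun j _ => lintegral_rpow_mul_exp_neg_sq_ne_zero _)
      (ENNReal.ofReal_pos.2 (Real.rpow_pos_of_pos Real.pi_pos _)).ne'
  have := neg_one_lt_of_lintegral_rpow_mul_exp_ne_top fun htop =>
    h (by rw [htop, ENNReal.top_mul hne])
  rw [rowWeight] at this
  linarith

theorem two_pow_card_mul_lintegral_relHaar {χ : I → ℝ} (hχ : ∀ i, (V.nRow i : ℝ) / 2 < χ i) :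
    2 ^ Fintype.card I *
      ∫⁻ g, ENNReal.ofReal (Real.exp (-V.sqNorm (g : LowerEntries A))) ∂V.relHaar χ =
        ENNReal.ofReal (V.gammaCone χ) := by
  have factor (i : I) : 2 * ∫⁻ t in Set.Ioi (0 : ℝ),
      ENNReal.ofReal (t ^ (2 * (χ i - V.rowWeight i)) * Real.exp (-t ^ 2)) =
        ENNReal.ofReal (Real.Gamma (χ i - (V.nRow i : ℝ) / 2)) := by
    rw [lintegral_rpow_mul_exp_neg_sq (by rw [rowWeight]; linarith [hχ i]), ← ENNReal.ofReal_ofNat,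
      ← ENNReal.ofReal_mul zero_le_two]
    congr 1
    rw [rowWeight]
    ring_nf
  rw [lintegral_relHaar, ← mul_assoc, ← Finset.card_univ, ← Finset.prod_const,
    ← Finset.prod_mul_distrib, Finset.prod_congr rfl fun i _ => factor i, mul_comm, gammaCone,
    nTot_sub_card, ENNReal.ofReal_mul (Real.rpow_nonneg Real.pi_pos.le _),
    ENNReal.ofReal_prod_of_nonneg fun i _ => (Real.Gamma_pos_of_pos (sub_pos.2 (hχ i))).le]

/-! ### Absolutely continuous Riesz measures -/

theorem isRiesz_withDensity {χ : I → ℝ} (hχ : ∀ i, (V.nRow i : ℝ) / 2 < χ i) :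
    V.IsRiesz χ (V.lebesgue.withDensity (V.cone.indicator fun Z =>
      ENNReal.ofReal ((V.gammaCone χ)⁻¹ * V.genPower (fun i => χ i + -V.nVal i) Z))) := by
  have hΓ := V.gammaCone_pos hχ
  rw [V.withDensity_genPower_eq_map_relHaar (inv_pos.2 hΓ).le,
    isRiesz_map_orbitMap_iff_isRelLeftInvariant]
  refine ⟨(V.isRelLeftInvariant_relHaar χ).smul_measure _, ?_⟩
  rw [lintegral_smul_measure, smul_eq_mul, ENNReal.ofReal_mul (inv_pos.2 hΓ).le, mul_assoc,
    ENNReal.ofReal_pow zero_le_two, ENNReal.ofReal_ofNat, V.two_pow_card_mul_lintegral_relHaar hχ,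
    ← ENNReal.ofReal_mul (inv_pos.2 hΓ).le, inv_mul_cancel₀ hΓ.ne', ENNReal.ofReal_one]

theorem exists_eq_map_orbitMap {R : Measure V.herm} (hR : R (closure V.cone)ᶜ = 0)
    (hac : R ≪ V.lebesgue) : ∃ m : Measure V.posLower, m.map V.orbitMap = R := by
  have hcone : R V.coneᶜ = 0 := by
    refine measure_mono_null (fun Z hZ => ?_)
      (measure_union_null hR (hac V.lebesgue_closure_diff_cone))
    by_cases h : Z ∈ closure V.cone
    exacts [Or.inr ⟨h, hZ⟩, Or.inl h]
  refine ⟨R.comap V.orbitMap, ?_⟩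
  rw [V.measurableEmbedding_orbitMap.map_comap, range_orbitMap]
  exact Measure.restrict_eq_self_of_ae_mem (mem_ae_iff.2 hcone)

theorem nRow_div_two_lt_of_absolutelyContinuous {χ : I → ℝ} {R : Measure V.herm}
    (hR : V.IsRiesz χ R) (hac : R ≪ V.lebesgue) (i : I) : (V.nRow i : ℝ) / 2 < χ i := by
  obtain ⟨m, rfl⟩ := V.exists_eq_map_orbitMap hR.1 hac
  obtain ⟨hm, hone⟩ := V.isRiesz_map_orbitMap_iff_isRelLeftInvariant.1 hR
  have : SigmaFinite m := sigmaFinite_of_lintegral_ne_top V.measurable_ofReal_exp_neg_sqNorm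
    (fun g => (ENNReal.ofReal_pos.2 (Real.exp_pos _)).ne') (hone.trans_ne ENNReal.one_ne_top)
  obtain ⟨c, rfl⟩ := hm.exists_eq_smul (V.isRelLeftInvariant_relHaar χ) (V.measurable_character χ)
    (V.character_pos χ) (V.relHaar_ne_zero χ)
  rw [lintegral_smul_measure, smul_eq_mul] at hone
  refine V.nRow_div_two_lt_of_lintegral_relHaar_ne_top (fun htop => ?_) i
  obtain rfl | hc := eq_or_ne c 0
  · simp at hone
  · simp [htop, ENNReal.mul_top hc] at hone

end VinbergAlgebra

theorem proposition3p5 {I : Type*} [Fintype I] [PartialOrder I] {A : I → I → Type*}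
    [∀ i j, NormedAddCommGroup (A i j)] [∀ i j, InnerProductSpace ℝ (A i j)]
    [∀ i j, FiniteDimensional ℝ (A i j)] [∀ i j, MeasurableSpace (A i j)]
    [∀ i j, BorelSpace (A i j)] (V : VinbergAlgebra A) (χ : I → ℝ) :
    (∀ R : Measure V.herm, V.IsRiesz χ R →
      (R ≪ V.lebesgue ↔ ∀ i, (V.nRow i : ℝ) / 2 < χ i)) ∧
    ((∀ i, (V.nRow i : ℝ) / 2 < χ i) → ∀ R : Measure V.herm, V.IsRiesz χ R ↔
      R = V.lebesgue.withDensity (V.cone.indicator fun Z =>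
        ENNReal.ofReal ((V.gammaCone χ)⁻¹ * V.genPower (fun i => χ i + -V.nVal i) Z))) := by
  refine ⟨fun R hR => ⟨fun hac i => V.nRow_div_two_lt_of_absolutelyContinuous hR hac i,
    fun hχ => ?_⟩, fun hχ R => ⟨fun hR => hR.unique (V.isRiesz_withDensity hχ), ?_⟩⟩
  · rw [hR.unique (V.isRiesz_withDensity hχ)]
    exact withDensity_absolutelyContinuous _ _
  · rintro rfl
    exact V.isRiesz_withDensity hχ
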